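/- Let $g$ be a known probability density on $\mathbb R$, let $m\ge 1$ be an integer, and let $f$ be a square-integrable probability density. Let $Y_1,\dots,Y_n$ ($n\ge 2$) be i.i.d. with density $h=g*f$. Write $\tilde u(t)=\int e^{-itx}u(x)\,dx$, and for $\alpha>0$ put $$\tilde\varphi_\alpha(t)=\frac{\overline{\tilde g(t)}}{|\tilde g(t)|^2+\alpha|t|^{2m}},\qquad \varphi_\alpha(x)=\lim_{\rho\to\infty}\frac1{2\pi}\int_{-\rho}^{\rho}e^{itx}\tilde\varphi_\alpha(t)\,dt .$$ For a sample $Y_1',\dots,Y_{n_1}'$ of i.i.d. variables with density $h$ let $f_{n_1}^\alpha(x)=\frac1{n_1}\sum_{j=1}^{n_1}\varphi_\alpha(x-Y_j')$ be the smoothness-penalized deconvolution estimator, and let $$R(\alpha,n_1)=2\pi\Big(\mathbb E\int (f_{n_1}^\alpha(x)-f(x))^2\,dx-\int f(x)^2\,dx\Big)$$ be its (shifted and scaled) risk for the sample size $n_1\ge 1$. From the $n$ observations form $\tilde H_n(t)=\frac{n}{n-1}\Big(\big|\frac1n\sum_{j=1}^n e^{-itY_j}\big|^2-\frac1n\Big)$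 and the risk estimate $$\hat R(\alpha,n_1)=\frac{n_1-1}{n_1}\int|\tilde\varphi_\alpha(t)|^2\tilde H_n(t)\,dt-2\int\frac{\tilde\varphi_\alpha(t)}{\overline{\tilde g(t)}}\tilde H_n(t)\,dt+\frac1{n_1}\int|\tilde\varphi_\alpha(t)|^2\,dt ,$$ where the quotient is read as $0$ at points with $\tilde g(t)=0$. Let $\iota>0$, $\lambda$ and $M$ be real constants, and let $(b_j)$, $(r_j)$ be real sequences with $b_j\le M$ for all $j$. **(1)** There is a constant $C>0$, depending only on $g,m,\iota,\lambda,M$, such that for all $f$, $(b_j)$, $(r_j)$ as above, all $n\ge2$ and $n_1\ge1$ with $b_{n_1}>0$ and $r_{n_1}>0$, all $k_n\ge 0$, all $\alpha_1,\dots,\alpha_{k_n}$ with $\iota b_{n_1}\le\alpha_i\le\lambda b_{n_1}$, and all $\varepsilon>0$, $$\mathbb P\Big(\sup_{1\le i\le k_n} r_{n_1}^{-1}\big|\hat R(\alpha_i,n_1)-R(\alpha_i,n_1)\big|>\varepsilon\Big)\le 2k_n\exp\{-C\varepsilon^2n(r_{n_1}b_{n_1})^2\}$$ (a supremum over the empty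 set being $0$). **(2)** Let $Y_1,Y_2,\dots$ be an i.i.d. sequence with density $h$. For each $n$ let $n_1=n_1(n)$ and $k_n$ be natural numbers and let $\alpha_{n,1},\dots,\alpha_{n,k_n}$ be real numbers, such that for all large $n$ one has $n_1\ge1$, $b_{n_1}>0$, $r_{n_1}>0$ and $\iota b_{n_1}\le\alpha_{n,i}\le\lambda b_{n_1}$ for $1\le i\le k_n$. If $(r_{n_1}b_{n_1})^{-2}=o(n)$ and $k_n=o(\exp\{n(r_{n_1}b_{n_1})^2\})$ as $n\to\infty$, then $$\sup_{1\le i\le k_n}\big|\hat R(\alpha_{n,i},n_1)-R(\alpha_{n,i},n_1)\big|=o_p(r_{n_1}),$$ that is, $r_{n_1}^{-1}$ times the left-hand side converges to $0$ in probability. -/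

import Mathlib

open MeasureTheory ProbabilityTheory Filter Topology Asymptotics

noncomputable section

namespace SPeD

/-- `f` is a probability density function on the real line. -/
structure IsDensity (f : ℝ → ℝ) : Prop where
  nonneg : ∀ x, 0 ≤ f x
  integrable : Integrable f volume
  integral_eq_one : ∫ x, f x = 1

/-- The Fourier transform, with the convention `∫ e^{-itx} f(x) dx`. -/
def ft (f : ℝ → ℝ) (t : ℝ) : ℂ :=
  ∫ x : ℝ, Complex.exp (-(Complex.I * t * x)) * (f x : ℂ)

/-- The density `h = g * f` of an observation `Y = X + E`, where `X` has density `f` and the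
independent error `E` has density `g`. -/
def obsDensity (f g : ℝ → ℝ) (y : ℝ) : ℝ :=
  ∫ t, f t * g (y - t)

/-- The law of an observation: the measure on the line with density `h = g * f`. -/
def obsLaw (f g : ℝ → ℝ) : Measure ℝ :=
  volume.withDensity (fun y => ENNReal.ofReal (obsDensity f g y))

/-- The Fourier transform of the kernel of the estimator:
the conjugate of `ft g t`, divided by `|ft g t|² + α |t|^{2m}`. -/
def kernelFt (g : ℝ → ℝ) (m : ℕ) (α t : ℝ) : ℂ :=
  (starRingEnd ℂ) (ft g t) / (((‖ft g t‖ ^ 2 + α * |t| ^ (2 * m) : ℝ)) : ℂ)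

/-- The kernel `φ_α(x)`: the limit of `(2π)⁻¹ ∫_{-r}^{r} e^{itx} kernelFt(t) dt` as `r → ∞`.
(For `α > 0`, `m ≥ 1` and a density `g` the integrand is integrable on the line, so that this is
a genuine limit; its value is real.) -/
def kernel (g : ℝ → ℝ) (m : ℕ) (α x : ℝ) : ℂ :=
  limUnder atTop fun r : ℝ =>
    (1 / (2 * Real.pi) : ℂ) *
      ∫ t in (-r)..r, Complex.exp (Complex.I * t * x) * kernelFt g m α t

/-- The smoothness-penalized deconvolution estimator `f_n^α(x)`, from the data `y`. -/
def estimator (g : ℝ → ℝ) (m : ℕ) (α : ℝ) {n : ℕ} (y : Fin n → ℝ) (x : ℝ) : ℂ :=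
  (1 / n : ℂ) * ∑ j, kernel g m α (x - y j)

/-- The loss: the integrated squared error of the estimator. -/
def loss (f g : ℝ → ℝ) (m : ℕ) (α : ℝ) {n : ℕ} (y : Fin n → ℝ) : ℝ :=
  ∫ x, ‖estimator g m α y x - (f x : ℂ)‖ ^ 2

/-- The risk for the sample size `n`: the expected loss for an i.i.d. sample of size `n`. -/
def risk (f g : ℝ → ℝ) (m : ℕ) (α : ℝ) (n : ℕ) : ℝ :=
  ∫ y : Fin n → ℝ, loss f g m α y ∂(Measure.pi fun _ => obsLaw f g)

/-- The shifted and scaled risk `R(α, n) = 2π (risk - ‖f‖²)`. -/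
def surrogateRisk (f g : ℝ → ℝ) (m : ℕ) (α : ℝ) (n : ℕ) : ℝ :=
  2 * Real.pi * (risk f g m α n - ∫ x, f x ^ 2)

/-- The empirical Fourier transform `n⁻¹ ∑ e^{-it y_j}`. -/
def empFt {n : ℕ} (y : Fin n → ℝ) (t : ℝ) : ℂ :=
  (1 / n : ℂ) * ∑ j, Complex.exp (-(Complex.I * t * y j))

/-- The unbiased estimator of `|ft h t|²`, for `n ≥ 2` data points. -/
def sqFtEst {n : ℕ} (y : Fin n → ℝ) (t : ℝ) : ℝ :=
  (n : ℝ) / ((n : ℝ) - 1) * (‖empFt y t‖ ^ 2 - 1 / n)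

/-- The small-n risk criterion `R̂(α, n₁)`, computed from `n` data points.  The quotient
`kernelFt / conj (ft g)` is real (`kernelFt_div_im`), so nothing is lost by taking its real part. -/
def riskEst (g : ℝ → ℝ) (m : ℕ) (α : ℝ) (n₁ : ℕ) {n : ℕ} (y : Fin n → ℝ) : ℝ :=
  ((n₁ : ℝ) - 1) / n₁ * (∫ t, ‖kernelFt g m α t‖ ^ 2 * sqFtEst y t)
    - 2 * (∫ t, (kernelFt g m α t / (starRingEnd ℂ) (ft g t)).re * sqFtEst y t)
    + 1 / n₁ * ∫ t, ‖kernelFt g m α t‖ ^ 2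

theorem kernelFt_div_im (g : ℝ → ℝ) (m : ℕ) (α t : ℝ) :
    (kernelFt g m α t / (starRingEnd ℂ) (ft g t)).im = 0 := by
  unfold kernelFt
  by_cases h : (starRingEnd ℂ) (ft g t) = 0
  · simp [h]
  · rw [div_right_comm, div_self h, ← Complex.ofReal_one, ← Complex.ofReal_div,
      Complex.ofReal_im]

end SPeD

end

noncomputable section

namespace SPeD

/-! On the Fourier side both the criterion and its target are linear in the squared modulus of the
characteristic function of `h`. Plancherel turns the risk into the integral of `riskWeight` against
`‖ft f * ft g‖ ^ 2` plus a deterministic term (`surrogateRisk_eq`). The criterion is the same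
expression with `sqFtEst` in its place (`riskEst_eq`), and `sqFtEst` is unbiased, so the criterion
has mean exactly `surrogateRisk` (`integral_riskEst`).

The weight is at most three times `(penalty g m α t)⁻¹`, whose integral is of order `1 / α`, hence
of order `1 / b` in the allowed range (`exists_integral_inv_penalty_le_div`). Replacing one
observation moves `sqFtEst` by `8 / n`, so the criterion has bounded differences of order `1 / (n *
b)`. McDiarmid's inequality and a union bound give (1).

For (2) the union bound is too weak: when `ε` is small, `C * ε ^ 2` drops below 1 and `k_n = o(exp(n
(r b)²))` no longer suffices. Instead, `errorMajorant` dominates the error for all parameters at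
once. Its mean is of order `1 / (b * √n)`, and Markov's inequality gives a bound without `k`. -/

/-! ### Plancherel on `L¹ ∩ L²` -/

open FourierTransform ContDiff in
/-- On `L¹ ∩ L²` the `L²` Fourier transform is given by the Fourier integral. -/
theorem fourier_toLp_ae_eq {G : ℝ → ℂ} (h1 : Integrable G) (h2 : MemLp G 2) :
    ((𝓕 (h2.toLp G) : Lp ℂ 2 (volume : Measure ℝ)) : ℝ → ℂ) =ᵐ[volume] 𝓕 G := by
  have hc : Continuous (𝓕 G) :=
    VectorFourier.fourierIntegral_continuous Real.continuous_fourierChar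
      (by exact continuous_inner) h1
  -- Test functions are Schwartz, so the distributional `L²` transform can be moved onto `ψ`, and
  -- the multiplication formula moves it back onto the integrable `G`.
  refine ae_eq_of_integral_contDiff_smul_eq
    ((Lp.memLp _).locallyIntegrable (by norm_num)) hc.locallyIntegrable fun φ hφ hφc => ?_
  have hs1 : HasCompactSupport (Complex.ofRealCLM ∘ φ) := hφc.comp_left rfl
  have hs2 : ContDiff ℝ ∞ (Complex.ofRealCLM ∘ φ) := by fun_prop
  obtain ⟨ψ, hψv⟩ : ∃ ψ : SchwartzMap ℝ ℂ, ∀ x, ψ x = (φ x : ℂ) :=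
    ⟨hs1.toSchwartzMap hs2, fun x => by simp⟩
  have e := congrArg (fun T => T ψ) (Lp.fourier_toTemperedDistribution_eq (h2.toLp G))
  simp only [TemperedDistribution.fourier_apply, Lp.toTemperedDistribution_apply] at e
  have e2 : ∫ x, (𝓕 ψ) x • (h2.toLp G) x = ∫ x, (𝓕 ψ) x • G x := by
    refine integral_congr_ae ?_
    filter_upwards [h2.coeFn_toLp] with x hx
    rw [hx]
  have e3 : ∫ x, (𝓕 ψ) x • G x = ∫ x, ψ x • 𝓕 G x := by
    rw [SchwartzMap.fourier_coe]
    simpa using! VectorFourier.integral_fourierIntegral_smul_eq_flip (L := innerₗ ℝ)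
      Real.continuous_fourierChar continuous_inner (ψ.integrable (μ := volume)) h1
  have := e.symm.trans (e2.trans e3)
  simpa [hψv, Complex.real_smul] using this

open FourierTransform in
theorem memLp_fourier {G : ℝ → ℂ} (h1 : Integrable G) (h2 : MemLp G 2) : MemLp (𝓕 G) 2 :=
  (memLp_congr_ae (fourier_toLp_ae_eq h1 h2)).1 (Lp.memLp _)

open FourierTransform in
/-- **Plancherel's theorem** on `L¹ ∩ L²`. -/
theorem integral_norm_sq_fourier {G : ℝ → ℂ} (h1 : Integrable G) (h2 : MemLp G 2) :
    ∫ x, ‖𝓕 G x‖ ^ 2 = ∫ t, ‖G t‖ ^ 2 := by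
  have key : ∀ u : Lp ℂ 2 (volume : Measure ℝ), ‖u‖ ^ 2 = ∫ x, ‖u x‖ ^ 2 := fun u => by
    have := L2.inner_def (𝕜 := ℝ) u u
    rw [real_inner_self_eq_norm_sq] at this
    simpa using this
  have := congrArg (· ^ 2) (Lp.norm_fourier_eq (h2.toLp G))
  simp only [key] at this
  calc _ = _ := integral_congr_ae (by
        filter_upwards [fourier_toLp_ae_eq h1 h2] with x hx; rw [hx])
    _ = _ := this
    _ = _ := integral_congr_ae (by filter_upwards [h2.coeFn_toLp] with x hx; rw [hx])

/-! ### Bounded differences inequality -/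

theorem abs_integral_le_of_forall_abs_le {X : Type*} [MeasurableSpace X] (μ : Measure X)
    [IsProbabilityMeasure μ] {f : X → ℝ} {C : ℝ} (h : ∀ x, |f x| ≤ C) : |∫ x, f x ∂μ| ≤ C :=
  le_trans (norm_integral_le_of_norm_le_const (f := f) (ae_of_all _ h))
    (by rw [probReal_univ, mul_one])

/-- Exponential form of McDiarmid's bounded differences inequality. -/
theorem integral_exp_le_of_bounded_differences (ν : Measure ℝ) [IsProbabilityMeasure ν]
    (c : ℝ) (hc : 0 ≤ c) (s : ℝ) : ∀ (n : ℕ) (F : (Fin n → ℝ) → ℝ), Measurable F →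
    (∃ B, ∀ y, |F y| ≤ B) →
    (∀ y i v, |F (Function.update y i v) - F y| ≤ c) →
    ∫ y, Real.exp (s * (F y - ∫ z, F z ∂(Measure.pi fun _ => ν))) ∂(Measure.pi fun _ => ν)
      ≤ Real.exp (n * (c ^ 2 * s ^ 2 / 2)) := by
  intro n
  induction n with
  | zero =>
    intro F _ _ _
    rw [Nat.cast_zero, zero_mul, Real.exp_zero]
    have : ∀ y, F y = F default := fun y => congrArg F (Subsingleton.elim _ _)
    simp_rw [this]
    simp
  | succ n ih =>
    intro F hF ⟨B, hB⟩ hd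
    -- Peel off the first coordinate: with `G` the mean over the others, `F - m = (F - G) + (G -
    -- m)`. The induction hypothesis controls the first summand for each fixed first coordinate,
    -- Hoeffding's lemma the second.
    have mp := (measurePreserving_piFinSuccAbove (fun _ : Fin (n+1) => ν) 0).symm
    set e := (MeasurableEquiv.piFinSuccAbove (fun _ : Fin (n+1) => ℝ) 0).symm with he
    have hev : ∀ p : ℝ × (Fin n → ℝ), e p = Fin.cons p.1 p.2 := fun p => by
      ext j; refine Fin.cases ?_ (fun j => ?_) j <;> simp [he, MeasurableEquiv.piFinSuccAbove]
    set G : ℝ → ℝ := fun x => ∫ z, F (e (x, z)) ∂(Measure.pi fun _ : Fin n => ν) with hG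
    have hFe : Measurable fun p => F (e p) := hF.comp e.measurable
    have hint : ∀ x, Integrable (fun z => F (e (x, z))) (Measure.pi fun _ : Fin n => ν) := fun x =>
      Integrable.of_bound (hFe.comp measurable_prodMk_left).aestronglyMeasurable B
        (ae_of_all _ fun z => hB _)
    have hGm : Measurable G := by
      have : StronglyMeasurable (Function.uncurry fun x z => F (e (x, z))) :=
        hFe.stronglyMeasurable
      exact this.integral_prod_right.measurable
    have hmean : ∫ z, F z ∂(Measure.pi fun _ : Fin (n+1) => ν) = ∫ x, G x ∂ν := by
      rw [← mp.integral_comp e.measurableEmbedding F, integral_prod]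
      exact Integrable.of_bound hFe.aestronglyMeasurable B (ae_of_all _ fun z => hB _)
    have hGd : ∀ x x', |G x - G x'| ≤ c := fun x x' => by
      rw [hG]; dsimp only
      rw [← integral_sub (hint x) (hint x')]
      refine abs_integral_le_of_forall_abs_le _ fun z => ?_
      have := hd (e (x', z)) 0 x
      rw [hev, hev] at *
      simpa using this
    have hinner : ∀ x, ∫ z, Real.exp (s * (F (e (x, z)) - G x)) ∂(Measure.pi fun _ : Fin n => ν)
        ≤ Real.exp (n * (c ^ 2 * s ^ 2 / 2)) := fun x => by
      refine ih (fun z => F (e (x, z))) (hFe.comp measurable_prodMk_left) ⟨B, fun z => hB _⟩ ?_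
      intro z i v
      have := hd (e (x, z)) i.succ v
      simp only [hev] at this ⊢
      simpa using this
    set m := ∫ x, G x ∂ν with hm
    have hGb : ∀ x, |G x| ≤ B := fun x => abs_integral_le_of_forall_abs_le _ fun z => hB _
    -- Centring at `G 0` gives an interval of length `2 * c`, whence `c ^ 2 * s ^ 2 / 2` instead of
    -- the sharp `c ^ 2 * s ^ 2 / 8`; only the value of `C` suffers.
    have houter : ∫ x, Real.exp (s * (G x - m)) ∂ν ≤ Real.exp (c ^ 2 * s ^ 2 / 2) := by
      have h := hasSubgaussianMGF_of_mem_Icc (X := G) (μ := ν) (a := G 0 - c) (b := G 0 + c)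
        hGm.aemeasurable (ae_of_all _ fun x => by
          have := abs_le.1 (hGd x 0); constructor <;> linarith)
      have h2 := h.mgf_le s
      refine h2.trans (Real.exp_le_exp.2 (le_of_eq ?_))
      have : ‖G 0 + c - (G 0 - c)‖ / 2 = c := by
        rw [Real.norm_eq_abs, abs_of_nonneg (by linarith)]; ring
      rw [NNReal.coe_pow, NNReal.coe_div, coe_nnnorm, NNReal.coe_ofNat, this]
    have hbd : ∀ y, |s * (F y - m)| ≤ |s| * (B + |m|) := fun y => by
      rw [abs_mul]; gcongr; exact (abs_sub _ _).trans (by linarith [hB y])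
    rw [hmean, ← mp.integral_comp e.measurableEmbedding, integral_prod]
    swap
    · refine Integrable.of_bound (C := Real.exp (|s| * (B + |m|))) ?_ (ae_of_all _ fun p => ?_)
      · exact (((hFe.sub_const m).const_mul s).exp).aestronglyMeasurable
      · rw [Real.norm_eq_abs, Real.abs_exp]
        exact Real.exp_le_exp.2 ((le_abs_self _).trans (hbd _))
    have hsplit : ∀ x, ∫ z, Real.exp (s * (F (e (x, z)) - m)) ∂(Measure.pi fun _ : Fin n => ν)
        = Real.exp (s * (G x - m)) *
          ∫ z, Real.exp (s * (F (e (x, z)) - G x)) ∂(Measure.pi fun _ : Fin n => ν) := fun x => by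
      rw [← integral_const_mul]; congr 1; ext z; rw [← Real.exp_add]; ring_nf
    simp_rw [hsplit]
    calc _ ≤ ∫ x, Real.exp (s * (G x - m)) * Real.exp (n * (c ^ 2 * s ^ 2 / 2)) ∂ν := by
          refine integral_mono_of_nonneg (ae_of_all _ fun x => ?_) ?_ (ae_of_all _ fun x => ?_)
          · exact mul_nonneg (Real.exp_nonneg _) (integral_nonneg fun z => Real.exp_nonneg _)
          · refine Integrable.mul_const ?_ _
            refine Integrable.of_bound (C := Real.exp (|s| * (B + |m|)))
              (((hGm.sub_const m).const_mul s).exp).aestronglyMeasurable (ae_of_all _ fun p => ?_)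
            rw [Real.norm_eq_abs, Real.abs_exp]
            refine Real.exp_le_exp.2 ((le_abs_self _).trans ?_)
            rw [abs_mul]; gcongr; exact (abs_sub _ _).trans (by linarith [hGb p])
          · exact mul_le_mul_of_nonneg_left (hinner x) (Real.exp_nonneg _)
      _ ≤ Real.exp (c ^ 2 * s ^ 2 / 2) * Real.exp (n * (c ^ 2 * s ^ 2 / 2)) := by
          rw [integral_mul_const]; gcongr
      _ = _ := by rw [← Real.exp_add]; push_cast; ring_nf

/-- One-sided McDiarmid inequality. -/
theorem measureReal_sub_le_of_bounded_differences (ν : Measure ℝ) [IsProbabilityMeasure ν]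
    {c : ℝ} (hc : 0 < c) {n : ℕ} (hn : 0 < n) (F : (Fin n → ℝ) → ℝ) (hF : Measurable F)
    (hB : ∃ B, ∀ y, |F y| ≤ B) (hd : ∀ y i v, |F (Function.update y i v) - F y| ≤ c)
    {ε : ℝ} (hε : 0 ≤ ε) :
    (Measure.pi fun _ : Fin n => ν).real {y | ε ≤ F y - ∫ z, F z ∂(Measure.pi fun _ => ν)}
      ≤ Real.exp (-(ε ^ 2 / (2 * n * c ^ 2))) := by
  set m := ∫ z, F z ∂(Measure.pi fun _ : Fin n => ν)
  obtain ⟨B, hB⟩ := hB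
  have h : HasSubgaussianMGF (fun y => F y - m) (Real.toNNReal (n * c ^ 2))
      (Measure.pi fun _ : Fin n => ν) := by
    constructor
    · intro s
      refine integrable_exp_mul_of_mem_Icc (a := -B - m) (b := B - m)
        (hF.sub_const m).aemeasurable (ae_of_all _ fun y => ?_)
      have := abs_le.1 (hB y); constructor <;> linarith
    · intro s
      refine (integral_exp_le_of_bounded_differences ν c hc.le s n F hF ⟨B, hB⟩ hd).trans
        (le_of_eq ?_)
      rw [Real.coe_toNNReal _ (by positivity)]; ring_nf
  refine (h.measure_ge_le hε).trans (le_of_eq ?_)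
  rw [Real.coe_toNNReal _ (by positivity)]; ring_nf

/-- Two-sided McDiarmid inequality. -/
theorem measureReal_abs_sub_le_of_bounded_differences (ν : Measure ℝ) [IsProbabilityMeasure ν]
    {c : ℝ} (hc : 0 < c) {n : ℕ} (hn : 0 < n) (F : (Fin n → ℝ) → ℝ) (hF : Measurable F)
    (hB : ∃ B, ∀ y, |F y| ≤ B) (hd : ∀ y i v, |F (Function.update y i v) - F y| ≤ c)
    {ε : ℝ} (hε : 0 ≤ ε) :
    (Measure.pi fun _ : Fin n => ν).real {y | ε ≤ |F y - ∫ z, F z ∂(Measure.pi fun _ => ν)|}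
      ≤ 2 * Real.exp (-(ε ^ 2 / (2 * n * c ^ 2))) := by
  have h1 := measureReal_sub_le_of_bounded_differences ν hc hn F hF hB hd hε
  have h2 := measureReal_sub_le_of_bounded_differences ν hc hn (fun y => -F y) hF.neg
    (by simpa using hB) (fun y i v => by
      rw [← abs_neg]; convert hd y i v using 2; ring) hε
  rw [two_mul]
  refine (measureReal_mono ?_).trans ((measureReal_union_le _ _).trans (add_le_add h1 h2))
  intro y hy
  rcases le_abs.1 (show ε ≤ |_| from hy) with h | h
  · exact Or.inl h
  · right; simp only [Set.mem_ofPred_eq, integral_neg]; linarith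

/-! ### Characteristic functions and the law of an observation -/

theorem norm_exp_neg_I_mul (t x : ℝ) : ‖Complex.exp (-(Complex.I * t * x))‖ = 1 := by
  rw [Complex.norm_exp]; simp

theorem conj_exp_neg_I_mul (t x : ℝ) :
    (starRingEnd ℂ) (Complex.exp (-(Complex.I * t * x))) = Complex.exp (Complex.I * t * x) := by
  rw [← Complex.exp_conj]; simp

theorem norm_exp_I_mul (t x : ℝ) : ‖Complex.exp (Complex.I * t * x)‖ = 1 := by
  rw [Complex.norm_exp]; simp

open FourierTransform in
theorem ft_eq_fourier (f : ℝ → ℝ) (t : ℝ) :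
    ft f t = 𝓕 (fun x => (f x : ℂ)) (t / (2 * Real.pi)) := by
  rw [Real.fourier_real_eq_integral_exp_smul, ft]
  congr 1; ext x; rw [smul_eq_mul]; congr 2
  have : (Real.pi : ℂ) ≠ 0 := by exact_mod_cast Real.pi_ne_zero
  push_cast; field_simp

open FourierTransform in
theorem continuous_ft {f : ℝ → ℝ} (hf : Integrable f) : Continuous (ft f) := by
  have hc : Continuous (𝓕 (fun x => (f x : ℂ))) :=
    VectorFourier.fourierIntegral_continuous Real.continuous_fourierChar
      (by exact continuous_inner) hf.ofReal
  have : ft f = fun t => 𝓕 (fun x => (f x : ℂ)) (t / (2 * Real.pi)) := funext (ft_eq_fourier f)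
  rw [this]; fun_prop

theorem IsDensity.ft_zero {f : ℝ → ℝ} (hf : IsDensity f) : ft f 0 = 1 := by
  simp only [ft, Complex.ofReal_zero, mul_zero, zero_mul, neg_zero, Complex.exp_zero, one_mul]
  rw [integral_complex_ofReal, hf.integral_eq_one, Complex.ofReal_one]

theorem IsDensity.norm_ft_le_one {f : ℝ → ℝ} (hf : IsDensity f) (t : ℝ) : ‖ft f t‖ ≤ 1 := by
  refine (norm_integral_le_integral_norm _).trans (le_of_eq ?_)
  simp_rw [norm_mul, norm_exp_neg_I_mul, one_mul, Complex.norm_real, Real.norm_eq_abs,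
    abs_of_nonneg (hf.nonneg _)]
  exact hf.integral_eq_one

open ContinuousLinearMap Convolution in
theorem isDensity_obsDensity {f g : ℝ → ℝ} (hf : IsDensity f) (hg : IsDensity g) :
    IsDensity (obsDensity f g) where
  nonneg y := integral_nonneg fun t => mul_nonneg (hf.nonneg _) (hg.nonneg _)
  integrable := Integrable.integrable_convolution (lsmul ℝ ℝ) hf.integrable hg.integrable
  integral_eq_one := by
    have := integral_convolution (lsmul ℝ ℝ) hf.integrable hg.integrable
    rw [hf.integral_eq_one, hg.integral_eq_one] at this
    simpa [convolution_def, obsDensity] using this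

open ContinuousLinearMap Convolution FourierTransform in
theorem ft_obsDensity {f g : ℝ → ℝ} (hf : IsDensity f) (hg : IsDensity g) (t : ℝ) :
    ft (obsDensity f g) t = ft f t * ft g t := by
  simp only [ft_eq_fourier]
  refine Eq.trans ?_ (Real.fourier_mul_convolution_eq (R := ℂ) hf.integrable.ofReal
    hg.integrable.ofReal _)
  have : (fun x => (obsDensity f g x : ℂ))
      = (fun x => (f x : ℂ)) ⋆[mul ℂ ℂ] (fun x => (g x : ℂ)) := by
    funext x
    simp only [convolution_def, obsDensity, ContinuousLinearMap.mul_apply']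
    rw [← integral_complex_ofReal]
    simp only [Complex.ofReal_mul]
  rw [this]; rfl

theorem isProbabilityMeasure_obsLaw {f g : ℝ → ℝ} (hf : IsDensity f) (hg : IsDensity g) :
    IsProbabilityMeasure (obsLaw f g) := by
  have h := isDensity_obsDensity hf hg
  constructor
  rw [obsLaw, withDensity_apply _ MeasurableSet.univ, Measure.restrict_univ,
    ← ofReal_integral_eq_lintegral_ofReal h.integrable (ae_of_all _ h.nonneg),
    h.integral_eq_one, ENNReal.ofReal_one]

/-- The characteristic function of the law of an observation. -/
theorem integral_exp_obsLaw {f g : ℝ → ℝ} (hf : IsDensity f) (hg : IsDensity g) (t : ℝ) :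
    ∫ x, Complex.exp (-(Complex.I * t * x)) ∂(obsLaw f g) = ft f t * ft g t := by
  have h := isDensity_obsDensity hf hg
  rw [← ft_obsDensity hf hg, obsLaw, integral_withDensity_eq_integral_toReal_smul₀
    h.integrable.aemeasurable.ennreal_ofReal (ae_of_all _ fun _ => ENNReal.ofReal_lt_top), ft]
  congr 1; ext x
  rw [ENNReal.toReal_ofReal (h.nonneg x), Complex.real_smul, mul_comm]

/-! ### Bounds on the penalized denominator and the kernel -/

/-- The denominator of the Fourier transform of the kernel. -/
def penalty (g : ℝ → ℝ) (m : ℕ) (α t : ℝ) : ℝ := ‖ft g t‖ ^ 2 + α * |t| ^ (2 * m)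

/-- Near the origin `ft g` is close to 1 by continuity; away from it the penalty term grows at least
like `t ^ 2` because `1 ≤ m`. The cap `A` is what lets the first region absorb a factor `α`. -/
theorem exists_le_penalty {g : ℝ → ℝ} (hg : IsDensity g) {m : ℕ} (hm : 1 ≤ m) (A : ℝ)
    (hA : 0 < A) : ∃ c, 0 < c ∧ ∀ α, 0 < α → α ≤ A → ∀ t, c * α * (1 + t ^ 2) ≤ penalty g m α t := by
  obtain ⟨k, rfl⟩ := Nat.exists_eq_add_of_le' hm
  have hc := continuous_ft hg.integrable
  have h1 : ∀ᶠ t in 𝓝 (0 : ℝ), 1 / 2 < ‖ft g t‖ :=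
    hc.norm.continuousAt.eventually (lt_mem_nhds (by simp only [hg.ft_zero]; norm_num))
  obtain ⟨δ₀, hδ₀, h2⟩ := Metric.eventually_nhds_iff.1 h1
  set δ := min δ₀ 1 with hδ
  have hδ0 : 0 < δ := lt_min hδ₀ one_pos
  have hδ1 : δ ≤ 1 := min_le_right _ _
  -- The first entry makes the left side at most `1 / 4` for `|t| < δ ≤ 1`. The second comes from `t
  -- ^ 2 ≥ (δ ^ 2 + δ ^ 2 * t ^ 2) / 2` for `|t| ≥ δ`, with `m = k + 1`.
  refine ⟨min (1 / (8 * A)) ((δ ^ 2) ^ k * δ ^ 2 / 2), lt_min (by positivity) (by positivity), ?_⟩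
  intro α hα hαA t
  rcases lt_or_ge |t| δ with ht | ht
  · have h3 : 1 / 2 < ‖ft g t‖ := h2 (by
      rw [dist_zero_right, Real.norm_eq_abs]; exact ht.trans_le (min_le_left _ _))
    have ht2 : t ^ 2 ≤ 1 := by
      rw [← sq_abs]; exact pow_le_one₀ (abs_nonneg _) (ht.le.trans hδ1)
    calc _ ≤ 1 / (8 * A) * α * (1 + 1) := by gcongr; exact min_le_left _ _
      _ ≤ 1 / (8 * A) * A * (1 + 1) := by gcongr
      _ = (1 / 2) ^ 2 := by field_simp; norm_num
      _ ≤ ‖ft g t‖ ^ 2 := by gcongr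
      _ ≤ _ := le_add_of_nonneg_right (by positivity)
  · have ht2 : δ ^ 2 ≤ t ^ 2 := by rw [← sq_abs t]; gcongr
    calc _ ≤ (δ ^ 2) ^ k * δ ^ 2 / 2 * α * (1 + t ^ 2) := by gcongr; exact min_le_right _ _
      _ = α * ((δ ^ 2) ^ k * ((δ ^ 2 + δ ^ 2 * t ^ 2) / 2)) := by ring
      _ ≤ α * ((t ^ 2) ^ k * ((t ^ 2 + 1 * t ^ 2) / 2)) := by
          gcongr; exact pow_le_one₀ hδ0.le hδ1
      _ = α * |t| ^ (2 * (k + 1)) := by rw [pow_mul |t|, sq_abs]; ring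
      _ ≤ _ := le_add_of_nonneg_left (by positivity)

theorem penalty_pos {g : ℝ → ℝ} (hg : IsDensity g) {m : ℕ} (hm : 1 ≤ m) {α : ℝ} (hα : 0 < α)
    (t : ℝ) : 0 < penalty g m α t := by
  obtain ⟨c, hc, h⟩ := exists_le_penalty hg hm α hα
  exact lt_of_lt_of_le (by positivity) (h α hα le_rfl t)

theorem continuous_penalty {g : ℝ → ℝ} (hg : IsDensity g) (m : ℕ) (α : ℝ) :
    Continuous (penalty g m α) := by
  have := continuous_ft hg.integrable
  unfold penalty; fun_prop

theorem continuous_inv_penalty {g : ℝ → ℝ} (hg : IsDensity g) {m : ℕ} (hm : 1 ≤ m) {α : ℝ}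
    (hα : 0 < α) : Continuous fun t => (penalty g m α t)⁻¹ :=
  (continuous_penalty hg m α).inv₀ fun t => (penalty_pos hg hm hα t).ne'

/-- Comparison with the Cauchy density, of total mass `π`. Uniformity of `K` in `α` makes the final
constant independent of the sequences. -/
theorem exists_integral_inv_penalty_le {g : ℝ → ℝ} (hg : IsDensity g) {m : ℕ} (hm : 1 ≤ m)
    (A : ℝ) (hA : 0 < A) : ∃ K, 0 < K ∧ ∀ α, 0 < α → α ≤ A →
      Integrable (fun t => (penalty g m α t)⁻¹) ∧ ∫ t, (penalty g m α t)⁻¹ ≤ K / α := by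
  obtain ⟨c, hc, h⟩ := exists_le_penalty hg hm A hA
  refine ⟨c⁻¹ * Real.pi, by positivity, fun α hα hαA => ?_⟩
  have hb : ∀ t, (penalty g m α t)⁻¹ ≤ (c * α)⁻¹ * (1 + t ^ 2)⁻¹ := fun t => by
    rw [← mul_inv]
    exact inv_anti₀ (by positivity) (h α hα hαA t)
  have hi : Integrable fun t : ℝ => (c * α)⁻¹ * (1 + t ^ 2)⁻¹ :=
    integrable_inv_one_add_sq.const_mul _
  have hint : Integrable (fun t => (penalty g m α t)⁻¹) :=
    hi.mono' (continuous_inv_penalty hg hm hα).aestronglyMeasurable (ae_of_all _ fun t => by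
      rw [Real.norm_eq_abs, abs_of_pos (inv_pos.2 (penalty_pos hg hm hα t))]; exact hb t)
  refine ⟨hint, (integral_mono hint hi hb).trans (le_of_eq ?_)⟩
  rw [integral_const_mul, integral_univ_inv_one_add_sq, mul_inv]; ring

theorem integrable_inv_penalty {g : ℝ → ℝ} (hg : IsDensity g) {m : ℕ} (hm : 1 ≤ m) {α : ℝ}
    (hα : 0 < α) : Integrable fun t => (penalty g m α t)⁻¹ :=
  let ⟨_, _, h⟩ := exists_integral_inv_penalty_le hg hm α hα
  (h α hα le_rfl).1

theorem inv_penalty_antitone {g : ℝ → ℝ} (hg : IsDensity g) {m : ℕ} (hm : 1 ≤ m) {a α : ℝ}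
    (ha : 0 < a) (h : a ≤ α) (t : ℝ) : (penalty g m α t)⁻¹ ≤ (penalty g m a t)⁻¹ :=
  inv_anti₀ (penalty_pos hg hm ha t) (by unfold penalty; gcongr)

theorem norm_kernelFt {g : ℝ → ℝ} (hg : IsDensity g) {m : ℕ} (hm : 1 ≤ m) {α : ℝ}
    (hα : 0 < α) (t : ℝ) : ‖kernelFt g m α t‖ = ‖ft g t‖ * (penalty g m α t)⁻¹ := by
  rw [kernelFt, norm_div, RCLike.norm_conj, Complex.norm_real, Real.norm_eq_abs, ← penalty,
    abs_of_pos (penalty_pos hg hm hα t), div_eq_mul_inv]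

theorem norm_kernelFt_le {g : ℝ → ℝ} (hg : IsDensity g) {m : ℕ} (hm : 1 ≤ m) {α : ℝ}
    (hα : 0 < α) (t : ℝ) : ‖kernelFt g m α t‖ ≤ (penalty g m α t)⁻¹ := by
  rw [norm_kernelFt hg hm hα]
  exact mul_le_of_le_one_left (inv_nonneg.2 (penalty_pos hg hm hα t).le) (hg.norm_ft_le_one t)

/-- The numerator `‖ft g t‖ ^ 2` is part of the denominator and cancels one of its two powers, so
the integral costs `1 / α` and not `1 / α ^ 2`. -/
theorem norm_sq_kernelFt_le {g : ℝ → ℝ} (hg : IsDensity g) {m : ℕ} (hm : 1 ≤ m) {α : ℝ}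
    (hα : 0 < α) (t : ℝ) : ‖kernelFt g m α t‖ ^ 2 ≤ (penalty g m α t)⁻¹ := by
  have hp := penalty_pos hg hm hα t
  rw [norm_kernelFt hg hm hα, mul_pow]
  calc _ ≤ penalty g m α t * (penalty g m α t)⁻¹ ^ 2 := by
        gcongr; exact le_add_of_nonneg_right (by positivity)
    _ = _ := by field_simp

theorem continuous_kernelFt {g : ℝ → ℝ} (hg : IsDensity g) {m : ℕ} (hm : 1 ≤ m) {α : ℝ}
    (hα : 0 < α) : Continuous (kernelFt g m α) := by
  have h1 := continuous_ft hg.integrable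
  refine (Complex.continuous_conj.comp h1).div
    (Complex.continuous_ofReal.comp (continuous_penalty hg m α)) fun t => ?_
  exact_mod_cast (penalty_pos hg hm hα t).ne'

theorem integrable_kernelFt {g : ℝ → ℝ} (hg : IsDensity g) {m : ℕ} (hm : 1 ≤ m) {α : ℝ}
    (hα : 0 < α) : Integrable (kernelFt g m α) :=
  (integrable_inv_penalty hg hm hα).mono' (continuous_kernelFt hg hm hα).aestronglyMeasurable
    (ae_of_all _ (norm_kernelFt_le hg hm hα))

theorem integrable_norm_sq_kernelFt {g : ℝ → ℝ} (hg : IsDensity g) {m : ℕ} (hm : 1 ≤ m) {α : ℝ}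
    (hα : 0 < α) : Integrable fun t => ‖kernelFt g m α t‖ ^ 2 :=
  (integrable_inv_penalty hg hm hα).mono'
    ((continuous_kernelFt hg hm hα).norm.pow 2).aestronglyMeasurable
    (ae_of_all _ fun t => by
      rw [Real.norm_eq_abs, abs_of_nonneg (by positivity)]; exact norm_sq_kernelFt_le hg hm hα t)

/-- The real quotient `kernelFt / conj (ft g)`. -/
def kernelQuot (g : ℝ → ℝ) (m : ℕ) (α t : ℝ) : ℝ :=
  (kernelFt g m α t / (starRingEnd ℂ) (ft g t)).re

theorem abs_kernelQuot_le {g : ℝ → ℝ} (hg : IsDensity g) {m : ℕ} (hm : 1 ≤ m) {α : ℝ}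
    (hα : 0 < α) (t : ℝ) : |kernelQuot g m α t| ≤ (penalty g m α t)⁻¹ := by
  have hp := inv_pos.2 (penalty_pos hg hm hα t)
  refine (Complex.abs_re_le_norm _).trans ?_
  rw [norm_div, RCLike.norm_conj, norm_kernelFt hg hm hα]
  by_cases h : ‖ft g t‖ = 0
  · simp [h, hp.le]
  · rw [mul_div_cancel_left₀ _ h]

/-- Reading the quotient as 0 at zeros of `ft g` is harmless, since both sides vanish there. This
rewrites the cross term of the risk through `‖ft f * ft g‖ ^ 2`. -/
theorem kernelFt_mul_ft (g : ℝ → ℝ) (m : ℕ) (α t : ℝ) :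
    kernelFt g m α t * ft g t = ((kernelQuot g m α t * ‖ft g t‖ ^ 2 : ℝ) : ℂ) := by
  have h : ((kernelQuot g m α t : ℝ) : ℂ) = kernelFt g m α t / (starRingEnd ℂ) (ft g t) := by
    apply Complex.ext <;> simp [kernelQuot, kernelFt_div_im]
  rw [Complex.ofReal_mul, h, Complex.ofReal_pow, ← Complex.conj_mul']
  by_cases h0 : (starRingEnd ℂ) (ft g t) = 0
  · have : ft g t = 0 := by simpa using h0
    simp [this]
  · field_simp

theorem measurable_kernelQuot {g : ℝ → ℝ} (hg : IsDensity g) {m : ℕ} (hm : 1 ≤ m) {α : ℝ}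
    (hα : 0 < α) : Measurable (kernelQuot g m α) :=
  Complex.measurable_re.comp ((continuous_kernelFt hg hm hα).measurable.div
    (Complex.continuous_conj.comp (continuous_ft hg.integrable)).measurable)

theorem integrable_kernelQuot {g : ℝ → ℝ} (hg : IsDensity g) {m : ℕ} (hm : 1 ≤ m) {α : ℝ}
    (hα : 0 < α) : Integrable (kernelQuot g m α) :=
  (integrable_inv_penalty hg hm hα).mono' (measurable_kernelQuot hg hm hα).aestronglyMeasurable
    (ae_of_all _ (abs_kernelQuot_le hg hm hα))

/-- The weight of the estimated `|ft h|²` in the risk criterion. -/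
def riskWeight (g : ℝ → ℝ) (m : ℕ) (α : ℝ) (n₁ : ℕ) (t : ℝ) : ℝ :=
  ((n₁ : ℝ) - 1) / n₁ * ‖kernelFt g m α t‖ ^ 2 - 2 * kernelQuot g m α t

theorem integrable_riskWeight {g : ℝ → ℝ} (hg : IsDensity g) {m : ℕ} (hm : 1 ≤ m) {α : ℝ}
    (hα : 0 < α) (n₁ : ℕ) : Integrable (riskWeight g m α n₁) :=
  ((integrable_norm_sq_kernelFt hg hm hα).const_mul _).sub
    ((integrable_kernelQuot hg hm hα).const_mul _)

/-- One unit comes from the squared kernel, whose factor lies in `[0, 1]`, and two from the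
quotient. -/
theorem abs_riskWeight_le {g : ℝ → ℝ} (hg : IsDensity g) {m : ℕ} (hm : 1 ≤ m) {α : ℝ}
    (hα : 0 < α) {n₁ : ℕ} (hn₁ : 1 ≤ n₁) (t : ℝ) :
    |riskWeight g m α n₁ t| ≤ 3 * (penalty g m α t)⁻¹ := by
  have h1 := norm_sq_kernelFt_le hg hm hα t
  have h2 := abs_kernelQuot_le hg hm hα t
  have h3 : (1 : ℝ) ≤ n₁ := by exact_mod_cast hn₁
  have h4 : 0 ≤ ((n₁ : ℝ) - 1) / n₁ := div_nonneg (by linarith) (by linarith)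
  have h5 : ((n₁ : ℝ) - 1) / n₁ ≤ 1 := by rw [div_le_one (by linarith)]; linarith
  have h6 : ((n₁ : ℝ) - 1) / n₁ * ‖kernelFt g m α t‖ ^ 2 ≤ (penalty g m α t)⁻¹ :=
    (mul_le_of_le_one_left (by positivity) h5).trans h1
  have h7 : 0 ≤ ((n₁ : ℝ) - 1) / n₁ * ‖kernelFt g m α t‖ ^ 2 := mul_nonneg h4 (by positivity)
  have := abs_le.1 h2
  rw [riskWeight, abs_le]; constructor <;> linarith

/-! ### Integrated squared error in the frequency domain -/

/-- The inverse Fourier transform `(2π)⁻¹ ∫ e^{itx} G(t) dt`. -/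
def invFt (G : ℝ → ℂ) (x : ℝ) : ℂ :=
  (1 / (2 * Real.pi) : ℂ) * ∫ t : ℝ, Complex.exp (Complex.I * t * x) * G t

open FourierTransform in
theorem invFt_eq_fourier (G : ℝ → ℂ) (x : ℝ) :
    invFt G x = (1 / (2 * Real.pi) : ℂ) * 𝓕 G (x / (-(2 * Real.pi))) := by
  rw [Real.fourier_real_eq_integral_exp_smul, invFt]
  congr 2; ext t; rw [smul_eq_mul]; congr 2
  have : (Real.pi : ℂ) ≠ 0 := by exact_mod_cast Real.pi_ne_zero
  push_cast; field_simp

theorem integrable_exp_mul {G : ℝ → ℂ} (hG : Integrable G) (x : ℝ) :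
    Integrable fun t : ℝ => Complex.exp (Complex.I * t * x) * G t :=
  hG.bdd_mul (c := 1) (Continuous.aestronglyMeasurable (by fun_prop))
    (ae_of_all _ fun t => (norm_exp_I_mul t x).le)

theorem memLp_invFt {G : ℝ → ℂ} (h1 : Integrable G) (h2 : MemLp G 2) : MemLp (invFt G) 2 := by
  have h := memLp_fourier h1 h2
  have hm : AEStronglyMeasurable (invFt G) volume := by
    have : invFt G = _ := funext (invFt_eq_fourier G)
    rw [this]
    refine AEStronglyMeasurable.const_mul ?_ _
    have hc : Continuous (FourierTransform.fourier G) :=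
      VectorFourier.fourierIntegral_continuous Real.continuous_fourierChar
        (by exact continuous_inner) h1
    exact (hc.comp (continuous_id.div_const _)).aestronglyMeasurable
  rw [memLp_two_iff_integrable_sq_norm hm]
  have h3 := (memLp_two_iff_integrable_sq_norm h.1).1 h
  have h4 := (h3.comp_div (R := -(2 * Real.pi)) (neg_ne_zero.2 (by positivity))).const_mul
    (‖(1 / (2 * Real.pi) : ℂ)‖ ^ 2)
  refine h4.congr (ae_of_all _ fun x => ?_)
  simp only [invFt_eq_fourier, norm_mul, mul_pow]

theorem integral_norm_sq_invFt {G : ℝ → ℂ} (h1 : Integrable G) (h2 : MemLp G 2) :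
    ∫ x, ‖invFt G x‖ ^ 2 = 1 / (2 * Real.pi) * ∫ t, ‖G t‖ ^ 2 := by
  simp_rw [invFt_eq_fourier, norm_mul, mul_pow]
  rw [integral_const_mul,
    Measure.integral_comp_div (fun x => ‖FourierTransform.fourier G x‖ ^ 2),
    integral_norm_sq_fourier h1 h2, abs_neg, abs_of_pos (by positivity), smul_eq_mul, norm_div,
    norm_one, norm_mul, Complex.norm_real, Real.norm_eq_abs, abs_of_pos Real.pi_pos,
    Complex.norm_ofNat]
  have := Real.pi_pos
  field_simp

theorem integral_invFt_mul {G : ℝ → ℂ} (hG : Integrable G) {f : ℝ → ℝ} (hf : Integrable f) :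
    ∫ x, invFt G x * (f x : ℂ)
      = (1 / (2 * Real.pi) : ℂ) * ∫ t, G t * (starRingEnd ℂ) (ft f t) := by
  have h1 : ∀ x, invFt G x * (f x : ℂ) = (1 / (2 * Real.pi) : ℂ) *
      ∫ t : ℝ, Complex.exp (Complex.I * t * x) * G t * (f x : ℂ) := fun x => by
    rw [invFt, integral_mul_const, mul_assoc]
  simp_rw [h1]
  rw [integral_const_mul, integral_integral_swap]
  · congr 2; ext t
    rw [ft, ← integral_conj, ← integral_const_mul]
    congr 1; ext x
    rw [map_mul, conj_exp_neg_I_mul, Complex.conj_ofReal]; ring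
  · have h2 : Integrable (fun p : ℝ × ℝ => (f p.1 : ℂ) * G p.2) (volume.prod volume) :=
      hf.ofReal.mul_prod hG
    have h3 := h2.bdd_mul (c := 1)
      (f := fun p : ℝ × ℝ => Complex.exp (Complex.I * p.2 * p.1))
      (Continuous.aestronglyMeasurable (by fun_prop))
      (ae_of_all _ fun p => (norm_exp_I_mul p.2 p.1).le)
    refine h3.congr (ae_of_all _ fun p => ?_)
    simp only [Function.uncurry]; ring

/-- Expand the square: Plancherel handles the first term and Fubini the cross term. Leaving `∫ x, f
x ^ 2` alone avoids inverting `ft f`, which need not be integrable. -/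
theorem integral_norm_sq_invFt_sub {G : ℝ → ℂ} (h1 : Integrable G) (h2 : MemLp G 2)
    {f : ℝ → ℝ} (hf1 : Integrable f) (hf2 : MemLp f 2) :
    ∫ x, ‖invFt G x - (f x : ℂ)‖ ^ 2
      = 1 / (2 * Real.pi) *
        ((∫ t, ‖G t‖ ^ 2) - 2 * (∫ t, G t * (starRingEnd ℂ) (ft f t)).re) + ∫ x, f x ^ 2 := by
  have hi := memLp_invFt h1 h2
  have i1 : Integrable fun x => ‖invFt G x‖ ^ 2 := (memLp_two_iff_integrable_sq_norm hi.1).1 hi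
  have i2 : Integrable fun x => invFt G x * (f x : ℂ) := hi.integrable_mul hf2.ofReal
  have i3 : Integrable fun x => f x ^ 2 := hf2.integrable_sq
  have e : ∀ x, ‖invFt G x - (f x : ℂ)‖ ^ 2
      = ‖invFt G x‖ ^ 2 - 2 * (invFt G x * (f x : ℂ)).re + f x ^ 2 := fun x => by
    simp only [← Complex.normSq_eq_norm_sq, Complex.normSq_apply, Complex.sub_re, Complex.sub_im,
      Complex.ofReal_re, Complex.ofReal_im, Complex.mul_re]
    ring
  simp_rw [e]
  have i4 : Integrable fun x => 2 * (invFt G x * (f x : ℂ)).re := i2.re.const_mul 2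
  have i5 : Integrable fun x => ‖invFt G x‖ ^ 2 - 2 * (invFt G x * (f x : ℂ)).re := i1.sub i4
  rw [integral_add i5 i3, integral_sub i1 i4,
    integral_const_mul, integral_norm_sq_invFt h1 h2]
  have h4 : ∫ x, (invFt G x * (f x : ℂ)).re
      = 1 / (2 * Real.pi) * (∫ t, G t * (starRingEnd ℂ) (ft f t)).re := by
    have := integral_re i2
    simp only [RCLike.re_to_complex] at this
    rw [this, integral_invFt_mul h1 hf1]
    rw [show (1 / (2 * Real.pi) : ℂ) = ((1 / (2 * Real.pi) : ℝ) : ℂ) by push_cast; rfl,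
      Complex.re_ofReal_mul]
  rw [h4]; ring

theorem kernel_eq_invFt {g : ℝ → ℝ} (hg : IsDensity g) {m : ℕ} (hm : 1 ≤ m) {α : ℝ}
    (hα : 0 < α) (x : ℝ) : kernel g m α x = invFt (kernelFt g m α) x := by
  refine Tendsto.limUnder_eq (Tendsto.const_mul _ ?_)
  exact intervalIntegral_tendsto_integral (integrable_exp_mul (integrable_kernelFt hg hm hα) x)
    tendsto_neg_atTop_atBot tendsto_id

theorem norm_empFt_le_one {n : ℕ} (y : Fin n → ℝ) (t : ℝ) : ‖empFt y t‖ ≤ 1 := by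
  rw [empFt, norm_mul, norm_div, norm_one, Complex.norm_natCast]
  have : ‖∑ j, Complex.exp (-(Complex.I * t * y j))‖ ≤ n := by
    refine (norm_sum_le _ _).trans (le_of_eq ?_)
    simp [norm_exp_neg_I_mul]
  rw [one_div_mul_eq_div]
  exact div_le_one_of_le₀ this (Nat.cast_nonneg n)

theorem continuous_empFt (n : ℕ) : Continuous fun p : (Fin n → ℝ) × ℝ => empFt p.1 p.2 := by
  unfold empFt; fun_prop

/-- Translation by `y j` becomes multiplication by `e^{-it y_j}`, so averaging translated kernels
multiplies `kernelFt` by the empirical transform. -/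
theorem estimator_eq_invFt {g : ℝ → ℝ} (hg : IsDensity g) {m : ℕ} (hm : 1 ≤ m) {α : ℝ}
    (hα : 0 < α) {n : ℕ} (y : Fin n → ℝ) (x : ℝ) :
    estimator g m α y x = invFt (fun t => kernelFt g m α t * empFt y t) x := by
  have hi := integrable_kernelFt hg hm hα
  simp only [estimator, kernel_eq_invFt hg hm hα, invFt, empFt]
  rw [← Finset.mul_sum, ← integral_finsetSum _ fun j _ => integrable_exp_mul hi _, mul_left_comm,
    ← integral_const_mul]
  congr 2; ext t
  rw [Finset.mul_sum, Finset.mul_sum, Finset.mul_sum, Finset.mul_sum]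
  refine Finset.sum_congr rfl fun j _ => ?_
  have : Complex.exp (Complex.I * t * ((x - y j : ℝ) : ℂ))
      = Complex.exp (Complex.I * t * x) * Complex.exp (-(Complex.I * t * y j)) := by
    rw [← Complex.exp_add]; congr 1; push_cast; ring
  rw [this]; ring

theorem memLp_kernelFt_mul_empFt {g : ℝ → ℝ} (hg : IsDensity g) {m : ℕ} (hm : 1 ≤ m) {α : ℝ}
    (hα : 0 < α) {n : ℕ} (y : Fin n → ℝ) :
    Integrable (fun t => kernelFt g m α t * empFt y t) ∧
      MemLp (fun t => kernelFt g m α t * empFt y t) 2 := by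
  have hc : Continuous (empFt y) := by unfold empFt; fun_prop
  have hi := integrable_kernelFt hg hm hα
  refine ⟨hi.mul_bdd (c := 1) hc.aestronglyMeasurable (ae_of_all _ (norm_empFt_le_one y)), ?_⟩
  have hs : AEStronglyMeasurable (fun t => kernelFt g m α t * empFt y t) volume :=
    hi.1.mul hc.aestronglyMeasurable
  rw [memLp_two_iff_integrable_sq_norm hs]
  refine (integrable_norm_sq_kernelFt hg hm hα).mono' (hs.norm.pow 2) (ae_of_all _ fun t => ?_)
  rw [norm_pow, norm_norm, norm_mul]
  gcongr
  exact mul_le_of_le_one_right (norm_nonneg _) (norm_empFt_le_one y t)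

theorem loss_eq {f g : ℝ → ℝ} (hf : IsDensity f) (hf2 : MemLp f 2) (hg : IsDensity g) {m : ℕ}
    (hm : 1 ≤ m) {α : ℝ} (hα : 0 < α) {n : ℕ} (y : Fin n → ℝ) :
    loss f g m α y = 1 / (2 * Real.pi) * ((∫ t, ‖kernelFt g m α t‖ ^ 2 * ‖empFt y t‖ ^ 2)
      - 2 * (∫ t, kernelFt g m α t * (starRingEnd ℂ) (ft f t) * empFt y t).re) + ∫ x, f x ^ 2 := by
  obtain ⟨h1, h2⟩ := memLp_kernelFt_mul_empFt hg hm hα y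
  simp only [loss, estimator_eq_invFt hg hm hα]
  rw [integral_norm_sq_invFt_sub h1 h2 hf.integrable hf2]
  simp_rw [norm_mul, mul_pow, mul_right_comm]

/-! ### Moments of the empirical characteristic function -/

theorem integral_exp_eval (ν : Measure ℝ) [IsProbabilityMeasure ν] {n : ℕ} (j : Fin n) (t : ℝ) :
    ∫ y : Fin n → ℝ, Complex.exp (-(Complex.I * t * y j)) ∂(Measure.pi fun _ => ν)
      = ∫ x, Complex.exp (-(Complex.I * t * x)) ∂ν :=
  integral_comp_eval (μ := fun _ : Fin n => ν)
    (f := fun x : ℝ => Complex.exp (-(Complex.I * t * x)))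
    (Continuous.aestronglyMeasurable (by fun_prop))

theorem integrable_exp_eval (ν : Measure ℝ) [IsProbabilityMeasure ν] {n : ℕ} (j : Fin n) (t : ℝ) :
    Integrable (fun y : Fin n → ℝ => Complex.exp (-(Complex.I * t * y j)))
      (Measure.pi fun _ => ν) :=
  Integrable.of_bound (Continuous.aestronglyMeasurable (by fun_prop)) 1
    (ae_of_all _ fun y => (norm_exp_neg_I_mul t (y j)).le)

theorem integral_empFt (ν : Measure ℝ) [IsProbabilityMeasure ν] {n : ℕ} (hn : 1 ≤ n) (t : ℝ) :
    ∫ y : Fin n → ℝ, empFt y t ∂(Measure.pi fun _ => ν)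
      = ∫ x, Complex.exp (-(Complex.I * t * x)) ∂ν := by
  simp only [empFt]
  rw [integral_const_mul, integral_finsetSum _ fun j _ => integrable_exp_eval ν j t]
  simp_rw [integral_exp_eval]
  have : (n : ℂ) ≠ 0 := by exact_mod_cast (by omega : n ≠ 0)
  rw [Finset.sum_const, Finset.card_univ, Fintype.card_fin, nsmul_eq_mul]
  field_simp

theorem integral_exp_mul_conj_exp (ν : Measure ℝ) [IsProbabilityMeasure ν] {n : ℕ} {j k : Fin n}
    (hjk : j ≠ k) (t : ℝ) :
    ∫ y : Fin n → ℝ, Complex.exp (-(Complex.I * t * y j)) *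
        (starRingEnd ℂ) (Complex.exp (-(Complex.I * t * y k))) ∂(Measure.pi fun _ => ν)
      = ((‖∫ x, Complex.exp (-(Complex.I * t * x)) ∂ν‖ ^ 2 : ℝ) : ℂ) := by
  have hind : IndepFun (fun y : Fin n → ℝ => y j) (fun y => y k) (Measure.pi fun _ => ν) :=
    (iIndepFun_pi (μ := fun _ : Fin n => ν) (X := fun _ x => x) fun _ => aemeasurable_id).indepFun
      hjk
  have h2 := hind.comp (φ := fun x : ℝ => Complex.exp (-(Complex.I * t * x)))
    (ψ := fun x : ℝ => (starRingEnd ℂ) (Complex.exp (-(Complex.I * t * x))))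
    (Continuous.measurable (by fun_prop)) (Continuous.measurable (by fun_prop))
  have h3 := h2.integral_fun_mul_eq_mul_integral
    (Continuous.aestronglyMeasurable (by fun_prop))
    (Continuous.aestronglyMeasurable (by fun_prop))
  simp only [Function.comp_apply] at h3
  rw [h3, integral_exp_eval, integral_conj, integral_exp_eval, Complex.mul_conj']
  push_cast; rfl

/-- In the double sum the `n * (n - 1)` off-diagonal pairs factor by independence, and each of the
`n` diagonal terms is 1. -/
theorem integral_norm_sq_empFt (ν : Measure ℝ) [IsProbabilityMeasure ν] {n : ℕ} (hn : 1 ≤ n)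
    (t : ℝ) : ∫ y : Fin n → ℝ, ‖empFt y t‖ ^ 2 ∂(Measure.pi fun _ => ν)
      = ((n : ℝ) - 1) / n * ‖∫ x, Complex.exp (-(Complex.I * t * x)) ∂ν‖ ^ 2 + 1 / n := by
  set φ := ∫ x, Complex.exp (-(Complex.I * t * x)) ∂ν with hφ
  have hn0 : (n : ℂ) ≠ 0 := by exact_mod_cast (by omega : n ≠ 0)
  have h1 : ∀ y : Fin n → ℝ, ((‖empFt y t‖ ^ 2 : ℝ) : ℂ) = (1 / n : ℂ) ^ 2 *
      ∑ j, ∑ k, Complex.exp (-(Complex.I * t * y j)) *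
        (starRingEnd ℂ) (Complex.exp (-(Complex.I * t * y k))) := fun y => by
    rw [Complex.ofReal_pow, ← Complex.mul_conj', empFt, map_mul, map_sum, ← Finset.sum_mul_sum,
      map_div₀, map_one, Complex.conj_natCast]
    ring
  have h2 : ∀ j k : Fin n, Integrable (fun y : Fin n → ℝ => Complex.exp (-(Complex.I * t * y j)) *
        (starRingEnd ℂ) (Complex.exp (-(Complex.I * t * y k)))) (Measure.pi fun _ => ν) :=
    fun j k => Integrable.of_bound (Continuous.aestronglyMeasurable (by fun_prop)) 1
      (ae_of_all _ fun y => by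
        rw [norm_mul, RCLike.norm_conj, norm_exp_neg_I_mul, norm_exp_neg_I_mul, one_mul])
  have h3 : ∀ j k : Fin n, ∫ y : Fin n → ℝ, Complex.exp (-(Complex.I * t * y j)) *
        (starRingEnd ℂ) (Complex.exp (-(Complex.I * t * y k))) ∂(Measure.pi fun _ => ν)
      = ((‖φ‖ ^ 2 : ℝ) : ℂ) + if j = k then ((1 - ‖φ‖ ^ 2 : ℝ) : ℂ) else 0 := fun j k => by
    split_ifs with h
    · subst h
      simp_rw [Complex.mul_conj', norm_exp_neg_I_mul]
      simp
    · rw [integral_exp_mul_conj_exp ν h, add_zero]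
  have h4 : ((∫ y : Fin n → ℝ, ‖empFt y t‖ ^ 2 ∂(Measure.pi fun _ => ν) : ℝ) : ℂ)
      = ((((n : ℝ) - 1) / n * ‖φ‖ ^ 2 + 1 / n : ℝ) : ℂ) := by
    rw [← integral_complex_ofReal]
    simp_rw [h1]
    rw [integral_const_mul, integral_finsetSum _ fun j _ => integrable_finsetSum _ fun k _ => h2 j k]
    simp_rw [integral_finsetSum _ fun k _ => h2 _ k, h3]
    simp only [Finset.sum_add_distrib, Finset.sum_const, Finset.card_univ, Fintype.card_fin,
      nsmul_eq_mul, Finset.sum_ite_eq, Finset.mem_univ, if_true]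
    push_cast
    field_simp
    ring
  exact_mod_cast h4

/-- Fubini for a bounded random function against an integrable weight. -/
theorem integral_integral_mul_swap {𝕜 : Type*} [RCLike 𝕜] {X : Type*} [MeasurableSpace X]
    (P : Measure X) [IsProbabilityMeasure P] {w : ℝ → 𝕜} (hw : Integrable w)
    {Φ : X → ℝ → 𝕜} (hΦ : AEStronglyMeasurable (Function.uncurry Φ) (P.prod volume)) {B : ℝ}
    (hB : ∀ y t, ‖Φ y t‖ ≤ B) :
    Integrable (fun y => ∫ t, w t * Φ y t) P ∧
      ∫ y, (∫ t, w t * Φ y t) ∂P = ∫ t, w t * ∫ y, Φ y t ∂P := by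
  have hi : Integrable (Function.uncurry fun y t => w t * Φ y t) (P.prod volume) :=
    (hw.comp_snd P).mul_bdd (c := B) hΦ (ae_of_all _ fun p => hB p.1 p.2)
  refine ⟨hi.integral_prod_left, ?_⟩
  rw [integral_integral_swap hi]
  simp_rw [integral_const_mul]

theorem continuous_norm_sq_empFt (n : ℕ) :
    Continuous fun p : (Fin n → ℝ) × ℝ => ‖empFt p.1 p.2‖ ^ 2 :=
  (continuous_empFt n).norm.pow 2

theorem norm_sq_empFt_le_one {n : ℕ} (y : Fin n → ℝ) (t : ℝ) : ‖empFt y t‖ ^ 2 ≤ 1 :=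
  pow_le_one₀ (norm_nonneg _) (norm_empFt_le_one y t)

/-! ### The risk as an integral against `riskWeight` -/

theorem integrable_mul_norm_sq_ft {f g w : ℝ → ℝ} (hf : IsDensity f) (hg : IsDensity g)
    (hw : Integrable w) : Integrable fun t => w t * ‖ft f t * ft g t‖ ^ 2 := by
  refine hw.mul_bdd (c := 1) (Continuous.aestronglyMeasurable ?_) (ae_of_all _ fun t => ?_)
  · have := continuous_ft hf.integrable
    have := continuous_ft hg.integrable
    fun_prop
  · rw [norm_pow, norm_norm, norm_mul]
    exact pow_le_one₀ (by positivity)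
      (mul_le_one₀ (hf.norm_ft_le_one t) (norm_nonneg _) (hg.norm_ft_le_one t))

/-- Take expectations in `loss_eq`. The second moment of `empFt` yields the factor `(n₁ - 1) / n₁`
and the variance term; the shift removes `∫ f²` and the factor `2π` clears Plancherel's constant. -/
theorem surrogateRisk_eq {f g : ℝ → ℝ} (hf : IsDensity f) (hf2 : MemLp f 2) (hg : IsDensity g)
    {m : ℕ} (hm : 1 ≤ m) {α : ℝ} (hα : 0 < α) {n₁ : ℕ} (hn₁ : 1 ≤ n₁) :
    surrogateRisk f g m α n₁ = (∫ t, riskWeight g m α n₁ t * ‖ft f t * ft g t‖ ^ 2)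
      + 1 / n₁ * ∫ t, ‖kernelFt g m α t‖ ^ 2 := by
  have := isProbabilityMeasure_obsLaw hf hg
  set P := (Measure.pi fun _ : Fin n₁ => obsLaw f g)
  have hw1 := integrable_norm_sq_kernelFt hg hm hα
  have hw2 : Integrable fun t => kernelFt g m α t * (starRingEnd ℂ) (ft f t) :=
    (integrable_kernelFt hg hm hα).mul_bdd (c := 1)
      (Complex.continuous_conj.comp (continuous_ft hf.integrable)).aestronglyMeasurable
      (ae_of_all _ fun t => by
        rw [RCLike.norm_conj]; exact hf.norm_ft_le_one t)
  obtain ⟨i1, e1⟩ := integral_integral_mul_swap P hw1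
    (Φ := fun (y : Fin n₁ → ℝ) t => ‖empFt y t‖ ^ 2) (B := 1)
    (continuous_norm_sq_empFt n₁).aestronglyMeasurable
    (fun y t => by
      rw [norm_pow, norm_norm]; exact norm_sq_empFt_le_one y t)
  obtain ⟨i2, e2⟩ := integral_integral_mul_swap P hw2
    (Φ := fun (y : Fin n₁ → ℝ) t => empFt y t) (B := 1)
    (continuous_empFt n₁).aestronglyMeasurable norm_empFt_le_one
  simp_rw [P, integral_norm_sq_empFt (obsLaw f g) hn₁, integral_exp_obsLaw hf hg] at e1
  simp_rw [P, integral_empFt (obsLaw f g) hn₁, integral_exp_obsLaw hf hg] at e2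
  have i3 : Integrable (fun y : Fin n₁ → ℝ =>
      2 * (∫ t, kernelFt g m α t * (starRingEnd ℂ) (ft f t) * empFt y t).re) P := i2.re.const_mul 2
  have i4 : Integrable (fun y : Fin n₁ → ℝ => 1 / (2 * Real.pi) *
      ((∫ t, ‖kernelFt g m α t‖ ^ 2 * ‖empFt y t‖ ^ 2)
        - 2 * (∫ t, kernelFt g m α t * (starRingEnd ℂ) (ft f t) * empFt y t).re)) P :=
    (i1.sub i3).const_mul _
  have e3 : ∫ y : Fin n₁ → ℝ,
      (∫ t, kernelFt g m α t * (starRingEnd ℂ) (ft f t) * empFt y t).re ∂P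
      = ∫ t, kernelQuot g m α t * ‖ft f t * ft g t‖ ^ 2 := by
    have h := integral_re i2
    simp only [RCLike.re_to_complex] at h
    rw [h, e2]
    have h4 : ∀ t, kernelFt g m α t * (starRingEnd ℂ) (ft f t) * (ft f t * ft g t)
        = ((kernelQuot g m α t * ‖ft f t * ft g t‖ ^ 2 : ℝ) : ℂ) := fun t => by
      calc _ = (kernelFt g m α t * ft g t) * ((starRingEnd ℂ) (ft f t) * ft f t) := by ring
        _ = _ := by
          rw [kernelFt_mul_ft, Complex.conj_mul', norm_mul]; push_cast; ring
    simp_rw [h4]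
    rw [integral_complex_ofReal, Complex.ofReal_re]
  have hq1 := integrable_mul_norm_sq_ft hf hg hw1
  have hq2 := integrable_mul_norm_sq_ft hf hg (integrable_kernelQuot hg hm hα)
  have e4 : ∫ t, riskWeight g m α n₁ t * ‖ft f t * ft g t‖ ^ 2
      = ((n₁ : ℝ) - 1) / n₁ * (∫ t, ‖kernelFt g m α t‖ ^ 2 * ‖ft f t * ft g t‖ ^ 2)
        - 2 * ∫ t, kernelQuot g m α t * ‖ft f t * ft g t‖ ^ 2 := by
    rw [← integral_const_mul, ← integral_const_mul,
      ← integral_sub (hq1.const_mul _) (hq2.const_mul _)]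
    congr 1; ext t; rw [riskWeight]; ring
  have e5 : ∫ t, ‖kernelFt g m α t‖ ^ 2 *
        (((n₁ : ℝ) - 1) / n₁ * ‖ft f t * ft g t‖ ^ 2 + 1 / n₁)
      = ((n₁ : ℝ) - 1) / n₁ * (∫ t, ‖kernelFt g m α t‖ ^ 2 * ‖ft f t * ft g t‖ ^ 2)
        + 1 / n₁ * ∫ t, ‖kernelFt g m α t‖ ^ 2 := by
    rw [← integral_const_mul, ← integral_const_mul,
      ← integral_add (hq1.const_mul _) (hw1.const_mul _)]
    congr 1; ext t; ring
  rw [surrogateRisk, risk]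
  simp_rw [loss_eq hf hf2 hg hm hα]
  rw [integral_add i4 (integrable_const _), integral_const_mul,
    integral_sub i1 i3, integral_const_mul, e1, e3, e5, e4, integral_const, probReal_univ, one_smul]
  have := Real.pi_pos
  field_simp
  ring

/-! ### The estimator of the squared modulus -/

/-- The values lie between `-1 / (n - 1)` and 1, and `n ≥ 2` keeps the lower end above `-1`. -/
theorem abs_sqFtEst_le_one {n : ℕ} (hn : 2 ≤ n) (y : Fin n → ℝ) (t : ℝ) : |sqFtEst y t| ≤ 1 := by
  have h2 : (2 : ℝ) ≤ n := by exact_mod_cast hn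
  have h0 : 0 ≤ ‖empFt y t‖ ^ 2 := by positivity
  have h1 := norm_sq_empFt_le_one y t
  have e : sqFtEst y t = (n * ‖empFt y t‖ ^ 2 - 1) / ((n : ℝ) - 1) := by
    rw [sqFtEst]; field_simp
  have hp : (0 : ℝ) < n - 1 := by linarith
  rw [e, abs_div, abs_of_pos hp, div_le_one hp, abs_le]
  constructor <;> nlinarith

theorem continuous_sqFtEst (n : ℕ) : Continuous fun p : (Fin n → ℝ) × ℝ => sqFtEst p.1 p.2 := by
  have := continuous_norm_sq_empFt n
  unfold sqFtEst; fun_prop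

theorem integrable_norm_sq_empFt (ν : Measure ℝ) [IsProbabilityMeasure ν] (n : ℕ) (t : ℝ) :
    Integrable (fun y : Fin n → ℝ => ‖empFt y t‖ ^ 2) (Measure.pi fun _ => ν) :=
  Integrable.of_bound (Continuous.aestronglyMeasurable (by unfold empFt; fun_prop)) 1
    (ae_of_all _ fun y => by rw [norm_pow, norm_norm]; exact norm_sq_empFt_le_one y t)

/-- The centring and scaling in `sqFtEst` invert exactly the affine relation of
`integral_norm_sq_empFt`. -/
theorem integral_sqFtEst (ν : Measure ℝ) [IsProbabilityMeasure ν] {n : ℕ} (hn : 2 ≤ n) (t : ℝ) :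
    ∫ y : Fin n → ℝ, sqFtEst y t ∂(Measure.pi fun _ => ν)
      = ‖∫ x, Complex.exp (-(Complex.I * t * x)) ∂ν‖ ^ 2 := by
  have h2 : (2 : ℝ) ≤ n := by exact_mod_cast hn
  have hp : (n : ℝ) - 1 ≠ 0 := by linarith
  simp only [sqFtEst]
  rw [integral_const_mul, integral_sub (integrable_norm_sq_empFt ν n t) (integrable_const _),
    integral_norm_sq_empFt ν (by omega), integral_const, probReal_univ, one_smul,
    add_sub_cancel_right]
  field_simp

theorem norm_empFt_update_sub_le {n : ℕ} (hn : 1 ≤ n) (y : Fin n → ℝ) (i : Fin n) (v t : ℝ) :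
    ‖empFt (Function.update y i v) t - empFt y t‖ ≤ 2 / n := by
  have h : empFt (Function.update y i v) t - empFt y t = (1 / n : ℂ) *
      (Complex.exp (-(Complex.I * t * v)) - Complex.exp (-(Complex.I * t * y i))) := by
    rw [empFt, empFt, ← mul_sub, ← Finset.sum_sub_distrib]
    congr 1
    rw [Finset.sum_eq_single i]
    · rw [Function.update_self]
    · intro j _ hj; rw [Function.update_of_ne hj, sub_self]
    · simp
  rw [h, norm_mul, norm_div, norm_one, Complex.norm_natCast, one_div_mul_eq_div]
  gcongr
  refine (norm_sub_le _ _).trans (le_of_eq ?_)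
  rw [norm_exp_neg_I_mul, norm_exp_neg_I_mul]; norm_num

theorem abs_norm_sq_sub_norm_sq_le {z w : ℂ} (hz : ‖z‖ ≤ 1) (hw : ‖w‖ ≤ 1) :
    |‖z‖ ^ 2 - ‖w‖ ^ 2| ≤ 2 * ‖z - w‖ := by
  rw [sq_sub_sq, abs_mul, abs_of_nonneg (by positivity : 0 ≤ ‖z‖ + ‖w‖)]
  exact mul_le_mul (by linarith) (abs_norm_sub_norm_le z w) (abs_nonneg _) (by norm_num)

/-- The constant is `2 * 2 * (2 / n)`: the factor `n / (n - 1) ≤ 2`, the Lipschitz constant of the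
squared modulus on the unit disc, and the change of `empFt`. -/
theorem abs_sqFtEst_update_sub_le {n : ℕ} (hn : 2 ≤ n) (y : Fin n → ℝ) (i : Fin n) (v t : ℝ) :
    |sqFtEst (Function.update y i v) t - sqFtEst y t| ≤ 8 / n := by
  have h2 : (2 : ℝ) ≤ n := by exact_mod_cast hn
  have h1 := (abs_norm_sq_sub_norm_sq_le (norm_empFt_le_one (Function.update y i v) t)
    (norm_empFt_le_one y t)).trans
    (mul_le_mul_of_nonneg_left (norm_empFt_update_sub_le (by omega) y i v t) (by norm_num))
  have h3 : (n : ℝ) / (n - 1) ≤ 2 := by rw [div_le_iff₀ (by linarith)]; linarith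
  have h4 : 0 ≤ (n : ℝ) / (n - 1) := div_nonneg (by linarith) (by linarith)
  rw [sqFtEst, sqFtEst, ← mul_sub, sub_sub_sub_cancel_right, abs_mul, abs_of_nonneg h4]
  calc _ ≤ 2 * (2 * (2 / (n : ℝ))) := mul_le_mul h3 h1 (abs_nonneg _) (by norm_num)
    _ = _ := by ring

/-- Mean-square error `1 / n` of `empFt` gives mean absolute error of order `1 / √n`. In place of
Cauchy–Schwarz, `2 * u ≤ √n * u ^ 2 + 1 / √n` is used pointwise; the bias correction contributes the
remaining `2 / √n`. -/
theorem integral_abs_sqFtEst_sub_le (ν : Measure ℝ) [IsProbabilityMeasure ν] {n : ℕ} (hn : 2 ≤ n)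
    (t : ℝ) : ∫ y : Fin n → ℝ, |sqFtEst y t - ‖∫ x, Complex.exp (-(Complex.I * t * x)) ∂ν‖ ^ 2|
      ∂(Measure.pi fun _ => ν) ≤ 4 / √n := by
  have h2 : (2 : ℝ) ≤ n := by exact_mod_cast hn
  set φ := ∫ x, Complex.exp (-(Complex.I * t * x)) ∂ν with hφ
  set P : Measure (Fin n → ℝ) := Measure.pi fun _ => ν
  have hφ1 : ‖φ‖ ≤ 1 := by
    refine (norm_integral_le_of_norm_le_const (C := 1)
      (ae_of_all _ fun x => (norm_exp_neg_I_mul t x).le)).trans (by rw [probReal_univ, mul_one])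
  have hs : 0 < √(n : ℝ) := Real.sqrt_pos.2 (by linarith)
  have hss : √(n : ℝ) * √n = n := Real.mul_self_sqrt (by linarith)
  have hs1 : 1 ≤ √(n : ℝ) := Real.one_le_sqrt.2 (by linarith)
  have hce : Continuous fun y : Fin n → ℝ => empFt y t := by unfold empFt; fun_prop
  have hdb : ∀ y : Fin n → ℝ, ‖empFt y t - φ‖ ≤ 2 := fun y =>
    (norm_sub_le _ _).trans (by linarith [norm_empFt_le_one y t])
  have i1 : Integrable (fun y : Fin n → ℝ => ‖empFt y t - φ‖ ^ 2) P :=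
    Integrable.of_bound (Continuous.aestronglyMeasurable (by fun_prop)) (2 ^ 2)
      (ae_of_all _ fun y => by rw [norm_pow, norm_norm]; gcongr; exact hdb y)
  have i0 : Integrable (fun y : Fin n → ℝ => empFt y t) P :=
    Integrable.of_bound hce.aestronglyMeasurable 1 (ae_of_all _ fun y => norm_empFt_le_one y t)
  have e1 : ∫ y : Fin n → ℝ, ‖empFt y t - φ‖ ^ 2 ∂P ≤ 1 / n := by
    have hpt : ∀ y : Fin n → ℝ, ‖empFt y t - φ‖ ^ 2
        = ‖empFt y t‖ ^ 2 - 2 * (empFt y t * (starRingEnd ℂ) φ).re + ‖φ‖ ^ 2 := fun y => by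
      simp only [← Complex.normSq_eq_norm_sq, Complex.normSq_apply, Complex.sub_re,
        Complex.sub_im, Complex.mul_re, Complex.conj_re, Complex.conj_im]
      ring
    have i2 : Integrable (fun y : Fin n → ℝ => empFt y t * (starRingEnd ℂ) φ) P := i0.mul_const _
    have i3 : Integrable (fun y : Fin n → ℝ => 2 * (empFt y t * (starRingEnd ℂ) φ).re) P :=
      i2.re.const_mul 2
    have i4 : Integrable (fun y : Fin n → ℝ => ‖empFt y t‖ ^ 2
        - 2 * (empFt y t * (starRingEnd ℂ) φ).re) P := (integrable_norm_sq_empFt ν n t).sub i3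
    have e2 : ∫ y : Fin n → ℝ, (empFt y t * (starRingEnd ℂ) φ).re ∂P = ‖φ‖ ^ 2 := by
      have := integral_re i2
      simp only [RCLike.re_to_complex] at this
      rw [this, integral_mul_const, integral_empFt ν (by omega), Complex.mul_conj',
        ← Complex.ofReal_pow, Complex.ofReal_re]
    simp_rw [hpt]
    rw [integral_add i4 (integrable_const _), integral_sub (integrable_norm_sq_empFt ν n t) i3,
      integral_const_mul, e2, integral_norm_sq_empFt ν (by omega), integral_const, probReal_univ,
      one_smul]
    have : ((n : ℝ) - 1) / n * ‖φ‖ ^ 2 ≤ ‖φ‖ ^ 2 :=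
      mul_le_of_le_one_left (by positivity) (by rw [div_le_one (by linarith)]; linarith)
    linarith
  have hpt : ∀ y : Fin n → ℝ, |sqFtEst y t - ‖φ‖ ^ 2|
      ≤ √n * ‖empFt y t - φ‖ ^ 2 + 3 / √n := fun y => by
    have h3 : sqFtEst y t - ‖empFt y t‖ ^ 2 = (‖empFt y t‖ ^ 2 - 1) / ((n : ℝ) - 1) := by
      have hp : (n : ℝ) - 1 ≠ 0 := by linarith
      rw [sqFtEst]; field_simp; ring
    -- The correction is at most `1 / (n - 1)`, and `√n ≤ n ≤ 2 * (n - 1)` for `n ≥ 2`.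
    have h4 : |sqFtEst y t - ‖empFt y t‖ ^ 2| ≤ 2 / √n := by
      have h5 := norm_sq_empFt_le_one y t
      have h6 : 0 ≤ ‖empFt y t‖ ^ 2 := by positivity
      have hp : (0 : ℝ) < n - 1 := by linarith
      rw [h3, abs_div, abs_of_pos hp, div_le_div_iff₀ hp hs]
      have : |‖empFt y t‖ ^ 2 - 1| ≤ 1 := by rw [abs_le]; constructor <;> linarith
      nlinarith
    have h7 := abs_norm_sq_sub_norm_sq_le (norm_empFt_le_one y t) hφ1
    have h8 : 2 * ‖empFt y t - φ‖ ≤ √n * ‖empFt y t - φ‖ ^ 2 + 1 / √n := by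
      have := sq_nonneg (√n * ‖empFt y t - φ‖ - 1)
      rw [← sub_nonneg]
      have e : √n * ‖empFt y t - φ‖ ^ 2 + 1 / √n - 2 * ‖empFt y t - φ‖
          = (√n * ‖empFt y t - φ‖ - 1) ^ 2 / √n := by field_simp; ring
      rw [e]; positivity
    have h9 := abs_sub_le (sqFtEst y t) (‖empFt y t‖ ^ 2) (‖φ‖ ^ 2)
    have : 3 / √(n : ℝ) = 2 / √n + 1 / √n := by ring
    linarith
  calc _ ≤ ∫ y : Fin n → ℝ, (√n * ‖empFt y t - φ‖ ^ 2 + 3 / √n) ∂P :=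
        integral_mono_of_nonneg (ae_of_all _ fun y => abs_nonneg _)
          ((i1.const_mul _).add (integrable_const _)) (ae_of_all _ hpt)
    _ = √n * (∫ y : Fin n → ℝ, ‖empFt y t - φ‖ ^ 2 ∂P) + 3 / √n := by
        rw [integral_add (i1.const_mul _) (integrable_const _), integral_const_mul, integral_const,
          probReal_univ, one_smul]
    _ ≤ √n * (1 / n) + 3 / √n := by gcongr
    _ = √n * (1 / (√n * √n)) + 3 / √n := by rw [hss]
    _ = _ := by field_simp; norm_num

/-! ### Unbiasedness and concentration of the risk criterion -/

theorem integrable_mul_sqFtEst {w : ℝ → ℝ} (hw : Integrable w) {n : ℕ} (hn : 2 ≤ n)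
    (y : Fin n → ℝ) : Integrable fun t => w t * sqFtEst y t :=
  hw.mul_bdd (c := 1) (Continuous.aestronglyMeasurable (by unfold sqFtEst empFt; fun_prop))
    (ae_of_all _ fun t => abs_sqFtEst_le_one hn y t)

theorem riskEst_eq {g : ℝ → ℝ} (hg : IsDensity g) {m : ℕ} (hm : 1 ≤ m) {α : ℝ} (hα : 0 < α)
    (n₁ : ℕ) {n : ℕ} (hn : 2 ≤ n) (y : Fin n → ℝ) :
    riskEst g m α n₁ y = (∫ t, riskWeight g m α n₁ t * sqFtEst y t)
      + 1 / n₁ * ∫ t, ‖kernelFt g m α t‖ ^ 2 := by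
  have h1 := integrable_mul_sqFtEst (integrable_norm_sq_kernelFt hg hm hα) hn y
  have h2 := integrable_mul_sqFtEst (integrable_kernelQuot hg hm hα) hn y
  have e : ∫ t, riskWeight g m α n₁ t * sqFtEst y t
      = ((n₁ : ℝ) - 1) / n₁ * (∫ t, ‖kernelFt g m α t‖ ^ 2 * sqFtEst y t)
        - 2 * ∫ t, kernelQuot g m α t * sqFtEst y t := by
    rw [← integral_const_mul, ← integral_const_mul,
      ← integral_sub (h1.const_mul _) (h2.const_mul _)]
    congr 1; ext t; rw [riskWeight]; ring
  rw [riskEst, e]; rfl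

theorem measurable_riskWeight {g : ℝ → ℝ} (hg : IsDensity g) {m : ℕ} (hm : 1 ≤ m) {α : ℝ}
    (hα : 0 < α) (n₁ : ℕ) : Measurable (riskWeight g m α n₁) :=
  (((continuous_kernelFt hg hm hα).measurable.norm.pow_const 2).const_mul _).sub
    ((measurable_kernelQuot hg hm hα).const_mul _)

theorem measurable_riskEst {g : ℝ → ℝ} (hg : IsDensity g) {m : ℕ} (hm : 1 ≤ m) {α : ℝ}
    (hα : 0 < α) (n₁ : ℕ) {n : ℕ} (hn : 2 ≤ n) :
    Measurable fun y : Fin n → ℝ => riskEst g m α n₁ y := by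
  simp_rw [riskEst_eq hg hm hα n₁ hn]
  refine Measurable.add_const ?_ _
  have : Measurable fun p : (Fin n → ℝ) × ℝ => riskWeight g m α n₁ p.2 * sqFtEst p.1 p.2 :=
    ((measurable_riskWeight hg hm hα n₁).comp measurable_snd).mul (continuous_sqFtEst n).measurable
  exact this.stronglyMeasurable.integral_prod_right'.measurable

theorem integral_riskEst {f g : ℝ → ℝ} (hf : IsDensity f) (hf2 : MemLp f 2) (hg : IsDensity g)
    {m : ℕ} (hm : 1 ≤ m) {α : ℝ} (hα : 0 < α) {n₁ : ℕ} (hn₁ : 1 ≤ n₁) {n : ℕ} (hn : 2 ≤ n) :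
    ∫ y : Fin n → ℝ, riskEst g m α n₁ y ∂(Measure.pi fun _ => obsLaw f g)
      = surrogateRisk f g m α n₁ := by
  have := isProbabilityMeasure_obsLaw hf hg
  obtain ⟨i, e⟩ := integral_integral_mul_swap (Measure.pi fun _ : Fin n => obsLaw f g)
    (integrable_riskWeight hg hm hα n₁) (Φ := fun (y : Fin n → ℝ) t => sqFtEst y t) (B := 1)
    (continuous_sqFtEst n).aestronglyMeasurable (abs_sqFtEst_le_one hn)
  simp_rw [riskEst_eq hg hm hα n₁ hn]
  rw [integral_add i (integrable_const _), e, surrogateRisk_eq hf hf2 hg hm hα hn₁, integral_const,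
    probReal_univ, one_smul]
  simp_rw [integral_sqFtEst (obsLaw f g) hn, integral_exp_obsLaw hf hg]

theorem abs_integral_riskWeight_mul_le {g : ℝ → ℝ} (hg : IsDensity g) {m : ℕ} (hm : 1 ≤ m)
    {α : ℝ} (hα : 0 < α) {n₁ : ℕ} (hn₁ : 1 ≤ n₁) {u : ℝ → ℝ} {B : ℝ} (hu : ∀ t, |u t| ≤ B) :
    |∫ t, riskWeight g m α n₁ t * u t| ≤ 3 * B * ∫ t, (penalty g m α t)⁻¹ := by
  rw [← integral_const_mul, ← Real.norm_eq_abs]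
  refine norm_integral_le_of_norm_le ((integrable_inv_penalty hg hm hα).const_mul _)
    (ae_of_all _ fun t => ?_)
  rw [Real.norm_eq_abs, abs_mul]
  have hp := inv_pos.2 (penalty_pos hg hm hα t)
  calc _ ≤ 3 * (penalty g m α t)⁻¹ * B :=
        mul_le_mul (abs_riskWeight_le hg hm hα hn₁ t) (hu t) (abs_nonneg _) (by positivity)
    _ = _ := by ring

/-- Concentration of the risk estimate about the shifted risk. -/
theorem measureReal_abs_riskEst_sub_le {f g : ℝ → ℝ} (hf : IsDensity f) (hf2 : MemLp f 2)
    (hg : IsDensity g) {m : ℕ} (hm : 1 ≤ m) {α : ℝ} (hα : 0 < α) {n₁ : ℕ} (hn₁ : 1 ≤ n₁) {n : ℕ}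
    (hn : 2 ≤ n) {L : ℝ} (hL : 0 < L) (hαL : ∫ t, (penalty g m α t)⁻¹ ≤ L) {ε : ℝ} (hε : 0 ≤ ε) :
    (Measure.pi fun _ : Fin n => obsLaw f g).real
        {y | ε ≤ |riskEst g m α n₁ y - surrogateRisk f g m α n₁|}
      ≤ 2 * Real.exp (-(ε ^ 2 * n / (1152 * L ^ 2))) := by
  have := isProbabilityMeasure_obsLaw hf hg
  have hn0 : (0 : ℝ) < n := by exact_mod_cast (by omega : 0 < n)
  have hw := integrable_riskWeight hg hm hα n₁
  -- The difference bound is `3 * (8 / n) * L`: weight, change of `sqFtEst`, integral of the inverse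
  -- penalty. Then `1152 = 2 * 24 ^ 2`.
  have h := measureReal_abs_sub_le_of_bounded_differences (obsLaw f g) (c := 24 * L / n)
    (by positivity) (by omega : 0 < n) (fun y => riskEst g m α n₁ y)
    (measurable_riskEst hg hm hα n₁ hn)
    ⟨3 * 1 * (∫ t, (penalty g m α t)⁻¹) + |1 / n₁ * ∫ t, ‖kernelFt g m α t‖ ^ 2|, fun y => by
      rw [riskEst_eq hg hm hα n₁ hn]
      exact (abs_add_le _ _).trans (add_le_add_left
        (abs_integral_riskWeight_mul_le hg hm hα hn₁ (abs_sqFtEst_le_one hn y)) _)⟩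
    (fun y i v => by
      rw [riskEst_eq hg hm hα n₁ hn, riskEst_eq hg hm hα n₁ hn, add_sub_add_right_eq_sub,
        ← integral_sub (integrable_mul_sqFtEst hw hn _) (integrable_mul_sqFtEst hw hn _)]
      simp_rw [← mul_sub]
      refine (abs_integral_riskWeight_mul_le hg hm hα hn₁
        (abs_sqFtEst_update_sub_le hn y i v)).trans ?_
      calc _ ≤ 3 * (8 / (n : ℝ)) * L := by gcongr
        _ = _ := by ring) hε
  rw [integral_riskEst hf hf2 hg hm hα hn₁ hn] at h
  refine h.trans (le_of_eq ?_)
  congr 3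
  field_simp
  ring

theorem map_eq_pi_obsLaw {f g : ℝ → ℝ} {Ω : Type*} [MeasurableSpace Ω] {P : Measure Ω}
    [IsProbabilityMeasure P] {n : ℕ} {Y : Fin n → Ω → ℝ} (hY : iIndepFun Y P)
    (hl : ∀ j, HasLaw (Y j) (obsLaw f g) P) :
    P.map (fun ω j => Y j ω) = Measure.pi fun _ => obsLaw f g := by
  rw [(iIndepFun_iff_map_fun_eq_pi_map fun j => (hl j).aemeasurable).1 hY]
  simp_rw [(hl _).map_eq]

/-- Only an inequality is claimed, so `S` may be any set: a push-forward never decreases the outer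
measure of a preimage. -/
theorem measureReal_comp_sample_le {f g : ℝ → ℝ} (hf : IsDensity f) (hg : IsDensity g)
    {Ω : Type*} [MeasurableSpace Ω] {P : Measure Ω}
    [IsProbabilityMeasure P] {n : ℕ} {Y : Fin n → Ω → ℝ} (hY : iIndepFun Y P)
    (hl : ∀ j, HasLaw (Y j) (obsLaw f g) P) (S : Set (Fin n → ℝ)) :
    P.real {ω | (fun j => Y j ω) ∈ S} ≤ (Measure.pi fun _ : Fin n => obsLaw f g).real S := by
  have := isProbabilityMeasure_obsLaw hf hg
  rw [← map_eq_pi_obsLaw hY hl, Measure.real, Measure.real]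
  refine ENNReal.toReal_mono ?_ (Measure.le_map_apply
    (aemeasurable_pi_lambda _ fun j => (hl j).aemeasurable) S)
  rw [map_eq_pi_obsLaw hY hl]; exact measure_ne_top _ _

/-! ### A majorant uniform in the regularization parameter -/

/-- A majorant, over all regularization parameters at least `a`, of the error of `riskEst`. -/
def errorMajorant (f g : ℝ → ℝ) (m : ℕ) (a : ℝ) {n : ℕ} (y : Fin n → ℝ) : ℝ :=
  ∫ t, 3 * (penalty g m a t)⁻¹ * |sqFtEst y t - ‖ft f t * ft g t‖ ^ 2|

theorem norm_sq_ft_mul_ft_le_one {f g : ℝ → ℝ} (hf : IsDensity f) (hg : IsDensity g) (t : ℝ) :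
    ‖ft f t * ft g t‖ ^ 2 ≤ 1 := by
  rw [norm_mul]
  exact pow_le_one₀ (by positivity)
    (mul_le_one₀ (hf.norm_ft_le_one t) (norm_nonneg _) (hg.norm_ft_le_one t))

theorem abs_sqFtEst_sub_le_two {f g : ℝ → ℝ} (hf : IsDensity f) (hg : IsDensity g) {n : ℕ}
    (hn : 2 ≤ n) (y : Fin n → ℝ) (t : ℝ) : |sqFtEst y t - ‖ft f t * ft g t‖ ^ 2| ≤ 2 := by
  have h1 := abs_le.1 (abs_sqFtEst_le_one hn y t)
  have h2 := norm_sq_ft_mul_ft_le_one hf hg t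
  have h3 : 0 ≤ ‖ft f t * ft g t‖ ^ 2 := by positivity
  rw [abs_le]; constructor <;> linarith [h1.1, h1.2]

theorem continuous_abs_sqFtEst_sub {f g : ℝ → ℝ} (hf : IsDensity f) (hg : IsDensity g) (n : ℕ) :
    Continuous fun p : (Fin n → ℝ) × ℝ => |sqFtEst p.1 p.2 - ‖ft f p.2 * ft g p.2‖ ^ 2| := by
  have h1 := continuous_sqFtEst n
  have h2 := continuous_ft hf.integrable
  have h3 := continuous_ft hg.integrable
  fun_prop

/-- The deterministic terms cancel. Inside the integral the weight at `α` is dominated by the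
inverse penalty at the smallest admissible parameter, by antitonicity in `α`. -/
theorem abs_riskEst_sub_le_errorMajorant {f g : ℝ → ℝ} (hf : IsDensity f) (hf2 : MemLp f 2)
    (hg : IsDensity g) {m : ℕ} (hm : 1 ≤ m) {a α : ℝ} (ha : 0 < a) (haα : a ≤ α) {n₁ : ℕ}
    (hn₁ : 1 ≤ n₁) {n : ℕ} (hn : 2 ≤ n) (y : Fin n → ℝ) :
    |riskEst g m α n₁ y - surrogateRisk f g m α n₁| ≤ errorMajorant f g m a y := by
  have hα := ha.trans_le haα
  have hw := integrable_riskWeight hg hm hα n₁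
  rw [riskEst_eq hg hm hα n₁ hn, surrogateRisk_eq hf hf2 hg hm hα hn₁, add_sub_add_right_eq_sub,
    ← integral_sub (integrable_mul_sqFtEst hw hn _) (integrable_mul_norm_sq_ft hf hg hw),
    ← Real.norm_eq_abs]
  refine norm_integral_le_of_norm_le ?_ (ae_of_all _ fun t => ?_)
  · refine ((integrable_inv_penalty hg hm ha).const_mul 3).mul_bdd (c := 2)
      ((continuous_abs_sqFtEst_sub hf hg n).comp
        (continuous_const.prodMk continuous_id)).aestronglyMeasurable (ae_of_all _ fun t => ?_)
    rw [Real.norm_eq_abs, abs_abs]; exact abs_sqFtEst_sub_le_two hf hg hn y t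
  · rw [← mul_sub, Real.norm_eq_abs, abs_mul]
    gcongr
    exact (abs_riskWeight_le hg hm hα hn₁ t).trans
      (mul_le_mul_of_nonneg_left (inv_penalty_antitone hg hm ha haα t) (by norm_num))

theorem integral_errorMajorant_le {f g : ℝ → ℝ} (hf : IsDensity f) (hg : IsDensity g) {m : ℕ}
    (hm : 1 ≤ m) {a : ℝ} (ha : 0 < a) {n : ℕ} (hn : 2 ≤ n) :
    Integrable (fun y : Fin n → ℝ => errorMajorant f g m a y) (Measure.pi fun _ => obsLaw f g) ∧
    ∫ y : Fin n → ℝ, errorMajorant f g m a y ∂(Measure.pi fun _ => obsLaw f g)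
      ≤ 12 * (∫ t, (penalty g m a t)⁻¹) / √n := by
  have := isProbabilityMeasure_obsLaw hf hg
  have hi := (integrable_inv_penalty hg hm ha).const_mul 3
  obtain ⟨i, e⟩ := integral_integral_mul_swap (Measure.pi fun _ : Fin n => obsLaw f g) hi
    (Φ := fun (y : Fin n → ℝ) t => |sqFtEst y t - ‖ft f t * ft g t‖ ^ 2|) (B := 2)
    (continuous_abs_sqFtEst_sub hf hg n).aestronglyMeasurable (fun y t => by
      rw [Real.norm_eq_abs, abs_abs]; exact abs_sqFtEst_sub_le_two hf hg hn y t)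
  refine ⟨i, ?_⟩
  simp only [errorMajorant]
  rw [e]
  have hp := fun t => inv_pos.2 (penalty_pos hg hm ha t)
  calc _ ≤ ∫ t, 3 * (penalty g m a t)⁻¹ * (4 / √n) := by
        refine integral_mono_of_nonneg (ae_of_all _ fun t => ?_) (hi.mul_const _)
          (ae_of_all _ fun t => ?_)
        · exact mul_nonneg (by have := hp t; positivity) (integral_nonneg fun y => abs_nonneg _)
        · have h := integral_abs_sqFtEst_sub_le (obsLaw f g) hn t
          rw [integral_exp_obsLaw hf hg] at h
          exact mul_le_mul_of_nonneg_left h (by have := hp t; positivity)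
    _ = _ := by rw [integral_mul_const, integral_const_mul]; ring

theorem exists_integral_inv_penalty_le_div {g : ℝ → ℝ} (hg : IsDensity g) {m : ℕ} (hm : 1 ≤ m)
    {ι : ℝ} (hι : 0 < ι) (M : ℝ) : ∃ K, 0 < K ∧ ∀ b, 0 < b → b ≤ M → ∀ α, ι * b ≤ α →
      ∫ t, (penalty g m α t)⁻¹ ≤ K / b := by
  -- A cap for `ι * b`, kept positive by the `+ 1`; larger `α` are reduced to `ι * b` by
  -- monotonicity and need no cap.
  obtain ⟨K, hK, h⟩ := exists_integral_inv_penalty_le hg hm (ι * |M| + 1) (by positivity)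
  refine ⟨K / ι, by positivity, fun b hb hbM α hα => ?_⟩
  have hb' : 0 < ι * b := by positivity
  refine (integral_mono (integrable_inv_penalty hg hm (hb'.trans_le hα))
    (integrable_inv_penalty hg hm hb') (inv_penalty_antitone hg hm hb' hα)).trans
    ((h (ι * b) hb' ?_).2.trans (le_of_eq (by field_simp)))
  have : ι * b ≤ ι * |M| := by gcongr; exact hbM.trans (le_abs_self M)
  linarith

/-! ### The two tail bounds for the supremum -/

/-- The exponential bound, uniformly over finitely many regularization parameters. -/
theorem exists_measureReal_iSup_le {g : ℝ → ℝ} (hg : IsDensity g) {m : ℕ} (hm : 1 ≤ m)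
    {ι : ℝ} (hι : 0 < ι) (M : ℝ) : ∃ C : ℝ, 0 < C ∧
      ∀ (f : ℝ → ℝ), IsDensity f → MemLp f 2 volume →
      ∀ (b r : ℝ) (n n₁ : ℕ), b ≤ M → 2 ≤ n → 1 ≤ n₁ → 0 < b → 0 < r →
      ∀ (k : ℕ) (α : Fin k → ℝ), (∀ i, ι * b ≤ α i) →
      ∀ (Ω : Type*) [MeasurableSpace Ω] (P : Measure Ω) [IsProbabilityMeasure P]
        (Y : Fin n → Ω → ℝ), iIndepFun Y P → (∀ j, HasLaw (Y j) (obsLaw f g) P) →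
      ∀ ε : ℝ, 0 < ε →
        P.real {ω | ε < ⨆ i : Fin k, r⁻¹ *
            |riskEst g m (α i) n₁ (fun j => Y j ω) - surrogateRisk f g m (α i) n₁|}
          ≤ 2 * k * Real.exp (-(C * ε ^ 2 * n * (r * b) ^ 2)) := by
  obtain ⟨K, hK, h⟩ := exists_integral_inv_penalty_le_div hg hm hι M
  refine ⟨1 / (1152 * K ^ 2), by positivity, ?_⟩
  intro f hf hf2 b r n n₁ hbM hn hn₁ hb hr k α hα Ω _ P _ Y hY hl ε hε
  have hb' : 0 < ι * b := by positivity
  set S : Fin k → Set (Fin n → ℝ) := fun i =>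
    {y | ε * r ≤ |riskEst g m (α i) n₁ y - surrogateRisk f g m (α i) n₁|} with hS
  have hsub : {ω | ε < ⨆ i : Fin k, r⁻¹ *
      |riskEst g m (α i) n₁ (fun j => Y j ω) - surrogateRisk f g m (α i) n₁|}
      ⊆ ⋃ i, {ω | (fun j => Y j ω) ∈ S i} := by
    intro ω hω
    by_contra hc
    rw [Set.mem_iUnion, not_exists] at hc
    -- `0 ≤ ε` covers `k = 0`, where the supremum is 0 by convention.
    refine (not_le.2 (show ε < _ from hω)) (Real.iSup_le (fun i => ?_) hε.le)
    have := (not_le.1 (show ¬ (ε * r ≤ _) from hc i)).le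
    rw [inv_mul_le_iff₀ hr, mul_comm]
    exact this
  calc _ ≤ P.real (⋃ i, {ω | (fun j => Y j ω) ∈ S i}) := measureReal_mono hsub
    _ ≤ ∑ i, P.real {ω | (fun j => Y j ω) ∈ S i} := measureReal_iUnion_fintype_le _
    _ ≤ ∑ _i : Fin k, 2 * Real.exp (-(1 / (1152 * K ^ 2) * ε ^ 2 * n * (r * b) ^ 2)) := by
        refine Finset.sum_le_sum fun i _ => ?_
        refine (measureReal_comp_sample_le hf hg hY hl _).trans
          ((measureReal_abs_riskEst_sub_le hf hf2 hg hm (hb'.trans_le (hα i)) hn₁ hn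
            (L := K / b) (by positivity) (h b hb hbM _ (hα i)) (by positivity)).trans
            (le_of_eq ?_))
        congr 3
        field_simp
    _ = _ := by
        rw [Finset.sum_const, Finset.card_univ, Fintype.card_fin, nsmul_eq_mul]; ring

/-- Markov's inequality for `errorMajorant` at `ι * b`. Since that variable bounds every term of the
supremum, the estimate does not involve `k`. -/
theorem exists_measureReal_le_iSup_le {g : ℝ → ℝ} (hg : IsDensity g) {m : ℕ} (hm : 1 ≤ m)
    {ι : ℝ} (hι : 0 < ι) (M : ℝ) : ∃ K : ℝ, 0 < K ∧
      ∀ (f : ℝ → ℝ), IsDensity f → MemLp f 2 volume →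
      ∀ (b r : ℝ) (n n₁ : ℕ), b ≤ M → 2 ≤ n → 1 ≤ n₁ → 0 < b → 0 < r →
      ∀ (k : ℕ) (α : Fin k → ℝ), (∀ i, ι * b ≤ α i) →
      ∀ (Ω : Type*) [MeasurableSpace Ω] (P : Measure Ω) [IsProbabilityMeasure P]
        (Y : Fin n → Ω → ℝ), iIndepFun Y P → (∀ j, HasLaw (Y j) (obsLaw f g) P) →
      ∀ ε : ℝ, 0 < ε →
        P.real {ω | ε ≤ r⁻¹ * ⨆ i : Fin k,
            |riskEst g m (α i) n₁ (fun j => Y j ω) - surrogateRisk f g m (α i) n₁|}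
          ≤ K / ε * √(((r * b) ^ 2)⁻¹ / n) := by
  obtain ⟨K, hK, h⟩ := exists_integral_inv_penalty_le_div hg hm hι M
  refine ⟨12 * K, by positivity, ?_⟩
  intro f hf hf2 b r n n₁ hbM hn hn₁ hb hr k α hα Ω _ P _ Y hY hl ε hε
  have hb' : 0 < ι * b := by positivity
  have hnn : ∀ y : Fin n → ℝ, 0 ≤ errorMajorant f g m (ι * b) y := fun y =>
    integral_nonneg fun t =>
      mul_nonneg (by have := inv_pos.2 (penalty_pos hg hm hb' t); positivity) (abs_nonneg _)
  have hsub : {ω | ε ≤ r⁻¹ * ⨆ i : Fin k,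
      |riskEst g m (α i) n₁ (fun j => Y j ω) - surrogateRisk f g m (α i) n₁|}
      ⊆ {ω | (fun j => Y j ω) ∈ {y : Fin n → ℝ | ε * r ≤ errorMajorant f g m (ι * b) y}} := by
    intro ω hω
    have h1 : ⨆ i : Fin k,
        |riskEst g m (α i) n₁ (fun j => Y j ω) - surrogateRisk f g m (α i) n₁|
        ≤ errorMajorant f g m (ι * b) (fun j => Y j ω) :=
      Real.iSup_le (fun i => abs_riskEst_sub_le_errorMajorant hf hf2 hg hm hb' (hα i) hn₁ hn _)
        (hnn _)
    have h2 : ε ≤ r⁻¹ * _ := hω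
    rw [le_inv_mul_iff₀ hr, mul_comm] at h2
    exact h2.trans h1
  have hn0 : (0 : ℝ) < √n := Real.sqrt_pos.2 (by exact_mod_cast (by omega : 0 < n))
  obtain ⟨hi, hle⟩ := integral_errorMajorant_le hf hg hm hb' hn
  have hmk := mul_meas_ge_le_integral_of_nonneg (ae_of_all _ hnn) hi (ε * r)
  refine (measureReal_mono hsub).trans ((measureReal_comp_sample_le hf hg hY hl _).trans ?_)
  have hsq : √(((r * b) ^ 2)⁻¹ / n) = 1 / (r * b * √n) := by
    rw [Real.sqrt_div' _ (Nat.cast_nonneg n), Real.sqrt_inv, Real.sqrt_sq (by positivity)]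
    field_simp
  rw [hsq]
  have h3 : ∫ t, (penalty g m (ι * b) t)⁻¹ ≤ K / b := h b hb hbM _ le_rfl
  rw [← mul_le_mul_iff_right₀ (by positivity : 0 < ε * r)]
  calc _ ≤ _ := hmk
    _ ≤ _ := hle
    _ ≤ 12 * (K / b) / √n := by gcongr
    _ = _ := by field_simp

end SPeD

end

theorem mainTheorem1 (g : ℝ → ℝ) (hg : SPeD.IsDensity g) (m : ℕ) (hm : 1 ≤ m)
    (ι lam M : ℝ) (hι : 0 < ι) :
    (∃ C : ℝ, 0 < C ∧
      ∀ (f : ℝ → ℝ), SPeD.IsDensity f → MemLp f 2 volume →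
      ∀ (b r : ℕ → ℝ), (∀ j, b j ≤ M) →
      ∀ (n n₁ : ℕ), 2 ≤ n → 1 ≤ n₁ → 0 < b n₁ → 0 < r n₁ →
      ∀ (k : ℕ) (α : Fin k → ℝ), (∀ i, ι * b n₁ ≤ α i ∧ α i ≤ lam * b n₁) →
      ∀ (Ω : Type*) [MeasurableSpace Ω] (P : Measure Ω) [IsProbabilityMeasure P]
        (Y : Fin n → Ω → ℝ), iIndepFun Y P → (∀ j, HasLaw (Y j) (SPeD.obsLaw f g) P) →
      ∀ ε : ℝ, 0 < ε →
        P.real {ω | ε < ⨆ i : Fin k, (r n₁)⁻¹ *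
            |SPeD.riskEst g m (α i) n₁ (fun j => Y j ω) - SPeD.surrogateRisk f g m (α i) n₁|}
          ≤ 2 * k * Real.exp (-(C * ε ^ 2 * n * (r n₁ * b n₁) ^ 2))) ∧
    (∀ (f : ℝ → ℝ), SPeD.IsDensity f → MemLp f 2 volume →
      ∀ (b r : ℕ → ℝ), (∀ j, b j ≤ M) →
      ∀ (n₁ k : ℕ → ℕ) (α : (n : ℕ) → Fin (k n) → ℝ),
      (∀ᶠ n in atTop, 1 ≤ n₁ n ∧ 0 < b (n₁ n) ∧ 0 < r (n₁ n) ∧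
        ∀ i, ι * b (n₁ n) ≤ α n i ∧ α n i ≤ lam * b (n₁ n)) →
      (fun n : ℕ => ((r (n₁ n) * b (n₁ n)) ^ 2)⁻¹) =o[atTop] (fun n : ℕ => (n : ℝ)) →
      (fun n : ℕ => (k n : ℝ)) =o[atTop]
        (fun n : ℕ => Real.exp (n * (r (n₁ n) * b (n₁ n)) ^ 2)) →
      ∀ (Ω : Type*) [MeasurableSpace Ω] (P : Measure Ω) [IsProbabilityMeasure P]
        (Y : ℕ → Ω → ℝ), iIndepFun Y P → (∀ j, HasLaw (Y j) (SPeD.obsLaw f g) P) →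
        TendstoInMeasure P
          (fun (n : ℕ) (ω : Ω) => (r (n₁ n))⁻¹ * ⨆ i : Fin (k n),
            |SPeD.riskEst g m (α n i) (n₁ n) (fun j : Fin n => Y j ω)
              - SPeD.surrogateRisk f g m (α n i) (n₁ n)|)
          atTop (fun _ => 0)) := by

  constructor
  · obtain ⟨C, hC, h⟩ := SPeD.exists_measureReal_iSup_le hg hm hι M
    exact ⟨C, hC, fun f hf hf2 b r hbM n n₁ hn hn₁ hb hr k α hα Ω _ P _ Y hY hl ε hε =>
      h f hf hf2 (b n₁) (r n₁) n n₁ (hbM n₁) hn hn₁ hb hr k α (fun i => (hα i).1) Ω P Y hY hl ε hε⟩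
  · intro f hf hf2 b r hbM n₁ k α hev hrate _ Ω _ P _ Y hY hl
    obtain ⟨K, hK, h⟩ := SPeD.exists_measureReal_le_iSup_le hg hm hι M
    rw [tendstoInMeasure_iff_measureReal_norm]
    intro ε hε
    -- The rate hypothesis says precisely that the quantity under the root tends to 0.
    have hlim : Tendsto (fun n : ℕ => K / ε * √(((r (n₁ n) * b (n₁ n)) ^ 2)⁻¹ / n)) atTop
        (𝓝 0) := by
      have h1 := hrate.tendsto_div_nhds_zero
      have h2 := ((Real.continuous_sqrt.tendsto 0).comp h1).const_mul (K / ε)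
      simpa using h2
    refine tendsto_of_tendsto_of_tendsto_of_le_of_le' tendsto_const_nhds hlim
      (Eventually.of_forall fun n => measureReal_nonneg) ?_
    filter_upwards [hev, eventually_ge_atTop 2] with n ⟨hn₁, hb, hr, hα⟩ hn
    refine le_trans (le_of_eq ?_) (h f hf hf2 (b (n₁ n)) (r (n₁ n)) n (n₁ n) (hbM _) hn hn₁ hb hr
      (k n) (α n) (fun i => (hα i).1) Ω P (fun j => Y j)
      (hY.precomp Fin.val_injective) (fun j => hl j) ε hε)
    congr 1
    ext ω
    have h0 : 0 ≤ (r (n₁ n))⁻¹ * ⨆ i : Fin (k n),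
        |SPeD.riskEst g m (α n i) (n₁ n) (fun j : Fin n => Y j ω)
          - SPeD.surrogateRisk f g m (α n i) (n₁ n)| :=
      mul_nonneg (inv_nonneg.2 hr.le) (Real.iSup_nonneg fun i => abs_nonneg _)
    rw [Set.mem_ofPred_eq, Set.mem_ofPred_eq, sub_zero, Real.norm_of_nonneg h0]
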